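/- Let $L\ge 1$ be an integer and $0<\alpha<\beta$, and put $\rho=\alpha/\beta<1$. For $N\ge L$ consider the Markovian network of $N$ single-server queues with unbounded buffers in which customers arrive at total rate $N\alpha$, each arriving customer is allocated $L$ distinct queues uniformly at random and joins the shortest of them, ties being resolved uniformly, and every busy server works at rate $\beta$; inter-arrival times, allocations and services are independent and memoryless. The initial configuration is arbitrary (possibly random). Let $X^N_i(t)$ be the length of queue $i$ at time $t$ (with right-continuous paths having left limits), and set \[ R^N_t(k)=\frac1N\,\#\{1\le i\le N : X^N_i(t)\ge k\},\qquad \tilde u(k)=\rho^{\,1+L+\cdots+L^{k-1}},\qquad Z^N_t=N^{1/2}\,(R^N_t-\tilde u),\qquad k\in\mathbb N,\ t\ge 0, \] where empty sums are $0$, so that $\tilde u(0)=1$. For $\theta>0$ write $\|x\|_{L_2(g_\theta)}^2=\sum_{k\ge1}x(k)^2\,\theta^{-k}\in[0,\infty]$ for real sequences $x$ with $x(0)=0$. Let $\theta>0$, with $\theta\ne\rho$ in case $L=1$, and let $T\ge 0$. If \[ \limsup_{N\to\infty}\mathbf E\Bigl(\|Z^N_0\|_{L_2(g_\theta)}^2\Bigr)<\infty,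 \] then \[ \limsup_{N\to\infty}\mathbf E\Bigl(\sup_{0\le t\le T}\|Z^N_t\|_{L_2(g_\theta)}^2\Bigr)<\infty . \] -/

import Mathlib

open MeasureTheory ProbabilityTheory Filter Topology
open scoped NNReal ENNReal

noncomputable section

/-- The queues of minimal length among those of the sample `S`, in the configuration `x`. -/
def shortestQueues {N : ℕ} (x : Fin N → ℕ) (S : Finset (Fin N)) : Finset (Fin N) :=
  S.filter fun i => ∀ j ∈ S, x i ≤ x j

/-- Generator of the network of `N` single-server queues. Customers arrive at total rate `N α`;
each one is allocated `L` distinct queues uniformly at random and joins the shortest of them,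
ties being resolved uniformly; each busy server works at rate `β`. -/
def networkGenerator (α β : ℝ) (L N : ℕ) (f : (Fin N → ℕ) → ℝ) (x : Fin N → ℕ) : ℝ :=
  (N : ℝ) * α *
      ((∑ S ∈ Finset.powersetCard L (Finset.univ : Finset (Fin N)),
          (∑ i ∈ shortestQueues x S, (f (Function.update x i (x i + 1)) - f x))
            / ((shortestQueues x S).card : ℝ))
        / (N.choose L : ℝ))
    + β * ∑ i ∈ Finset.univ.filter (fun i => 0 < x i),
        (f (Function.update x i (x i - 1)) - f x)

/-- `X` is the Markov jump process of queue lengths in the network of size `N`, with an arbitrary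
initial law: its paths are right continuous with left limits in the discrete space `ℕ ^ N`, and it
solves the martingale problem for the (bounded) generator of the network. -/
structure IsNetworkProcess (α β : ℝ) (L N : ℕ) {Ω : Type*} [mΩ : MeasurableSpace Ω]
    (P : Measure Ω) (X : ℝ≥0 → Ω → (Fin N → ℕ)) : Prop where
  right_continuous : ∀ ω t, ContinuousWithinAt (fun s => X s ω) (Set.Ici t) t
  left_limits : ∀ ω t, ∃ l, Tendsto (fun s => X s ω) (𝓝[<] t) (𝓝 l)
  martingale_problem : ∃ 𝓕 : Filtration ℝ≥0 mΩ,
    (∀ t, Measurable[𝓕 t] (X t)) ∧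
    ∀ f : (Fin N → ℕ) → ℝ, (∃ C, ∀ x, |f x| ≤ C) →
      Martingale
        (fun (t : ℝ≥0) ω => f (X t ω) - f (X 0 ω)
          - ∫ s in (0 : ℝ)..t, networkGenerator α β L N f (X s.toNNReal ω))
        𝓕 P

/-- The fraction of queues of length at least `k` in the configuration `x`. -/
def tailFraction {N : ℕ} (x : Fin N → ℕ) (k : ℕ) : ℝ :=
  ((Finset.univ.filter fun i => k ≤ x i).card : ℝ) / (N : ℝ)

/-- The stable point `k ↦ ρ ^ (1 + L + ⋯ + L ^ (k - 1))`. -/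
def stablePoint (ρ : ℝ) (L k : ℕ) : ℝ :=
  ρ ^ (∑ j ∈ Finset.range k, L ^ j)

/-- The fluctuation `N ^ (1/2) (r - ũ)` of the empirical tail `r` of the configuration `x`. -/
def fluctuation (ρ : ℝ) (L : ℕ) {N : ℕ} (x : Fin N → ℕ) (k : ℕ) : ℝ :=
  Real.sqrt N * (tailFraction x k - stablePoint ρ L k)

/-- The geometric sequence of reason `θ`. -/
def geometricWeight (θ : ℝ) (k : ℕ) : ℝ := θ ^ k

/-- The squared norm of `L_2(w)`, namely the sum of `x(k) ^ 2 / w(k)` over `k ≥ 1`, with the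
value `∞` for sequences that are not in this space. -/
def weightedNormSq (w : ℕ → ℝ) (x : ℕ → ℝ) : ℝ≥0∞ :=
  ∑' k : ℕ, ENNReal.ofReal (x (k + 1) ^ 2 * (w (k + 1))⁻¹)

end

/-! Write r for the empirical tail, u for the stable point and Z for the fluctuation. Each r(k+1) is
a bounded function of the configuration, so the martingale problem applies to it and to its square.
Up to the effect of sampling without replacement, its drift is α(r(k)^L - r(k+1)^L) - β(r(k+1) -
r(k+2)), which vanishes at u because α u(k)^L = β u(k+1). After subtracting this equilibrium and
multiplying by N^(1/2), the drift is Lipschitz in Z(k), Z(k+1), Z(k+2). The jumps have size 1/N, so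
N times the bracket density is at most α r(k) + β r(k+1).

Both the bracket and the sampling error are thus controlled by r itself. Since N r is an integer, r
≤ 5 Z^2 + 3 u (`tailFraction_le_fluctuation_sq`). So N times the squared drift and N times the
bracket density are bounded, uniformly in N and k, by a constant times Z(k)^2 + Z(k+1)^2 + Z(k+2)^2
+ u(k) (`exists_drift_and_bracket_le`). Doob's inequality bounds the supremum in time of each
coordinate (`IsBoundedRightContinuous.lintegral_iSup_sq_le`). Summing against θ^(-k), whose
neighbouring values are comparable, gives an integral inequality for the mean squared norm, with
source term D = ∑ u(k) θ^(-k-1).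

Gronwall needs the mean squared norm to be finite beforehand. The weight is therefore first enlarged
to max(θ^k, δ 2^k), for which the norm is bounded for each N while all constants are independent of
δ; then δ is removed.

D is finite if L ≥ 2, or if L = 1 and ρ < θ (`tsum_stablePoint_ne_top`). If L = 1 and θ < ρ, the
assumption on the initial condition can never hold, because a multiple of 1/N cannot approximate ρ^k
well when ρ^k is about 1/(2N) (`exists_lt_weightedNormSq`). -/

/-! ### Joint measurability, and Doob's L² inequality along a grid. -/

/-- Rounding time up to the grid of mesh 1/(n+1) gives countably many times, hence jointly
measurable approximations, and these converge by right continuity. Fubini relies on this throughout.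
-/
theorem measurable_uncurry_of_right_continuous {Ω : Type*} [MeasurableSpace Ω]
    {Y : ℝ≥0 → Ω → ℝ} (hm : ∀ t, Measurable (Y t))
    (hc : ∀ ω t, ContinuousWithinAt (fun s => Y s ω) (Set.Ici t) t) :
    Measurable fun p : ℝ × Ω => Y p.1.toNNReal p.2 := by
  have key : Measurable fun p : ℝ≥0 × Ω => Y p.1 p.2 := by
    refine measurable_of_tendsto_metrizable
      (f := fun (n : ℕ) (p : ℝ≥0 × Ω) => Y ((⌈p.1 * (n + 1)⌉₊ : ℝ≥0) / (n + 1)) p.2) ?_ ?_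
    · intro n
      have h1 : Measurable fun p : ℕ × Ω => Y ((p.1 : ℝ≥0) / (n + 1)) p.2 :=
        measurable_from_prod_countable_right
          (f := fun p : ℕ × Ω => Y ((p.1 : ℝ≥0) / (n + 1)) p.2) fun i => hm ((i : ℝ≥0) / (n + 1))
      have h2 : Measurable fun p : ℝ≥0 × Ω => ((⌈p.1 * (n + 1)⌉₊ : ℕ), p.2) :=
        (Nat.measurable_ceil.comp (measurable_fst.mul_const _)).prodMk measurable_snd
      exact h1.comp h2
    · rw [tendsto_pi_nhds]
      rintro ⟨t, ω⟩
      refine (hc ω t).tendsto.comp (tendsto_nhdsWithin_iff.2 ⟨?_, Eventually.of_forall fun n => ?_⟩)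
      · have h := tendsto_nat_ceil_mul_div_atTop (R := ℝ) (a := t) t.2
        have h' := h.comp (tendsto_natCast_atTop_atTop.comp (tendsto_add_atTop_nat 1))
        rw [← NNReal.tendsto_coe]
        refine h'.congr fun n => ?_
        simp only [Function.comp, NNReal.coe_div, NNReal.coe_natCast, NNReal.coe_add, NNReal.coe_one,
          Nat.cast_add, Nat.cast_one]
        congr 2
      · rw [Set.mem_Ici, le_div_iff₀ (by positivity)]
        exact Nat.le_ceil _
  exact key.comp ((measurable_real_toNNReal.comp measurable_fst).prodMk measurable_snd)

/-- The maximum of `0` and of the terms `a 1, …, a n`. -/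
def runningMax (a : ℕ → ℝ) : ℕ → ℝ
  | 0 => 0
  | n + 1 => max (runningMax a n) (a (n + 1))

theorem runningMax_nonneg (a : ℕ → ℝ) (n : ℕ) : 0 ≤ runningMax a n := by
  induction n with
  | zero => exact le_rfl
  | succ n ih => exact ih.trans (le_max_left _ _)

theorem le_runningMax {a : ℕ → ℝ} (h0 : a 0 = 0) {i n : ℕ} (h : i ≤ n) :
    a i ≤ runningMax a n := by
  induction n with
  | zero => simp [Nat.le_zero.1 h, h0, runningMax]
  | succ n ih =>
    rcases Nat.le_succ_iff.1 h with h | rfl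
    · exact (ih h).trans (le_max_left _ _)
    · exact le_max_right _ _

theorem runningMax_le {a : ℕ → ℝ} {C : ℝ} (hC : 0 ≤ C) (h : ∀ i, a i ≤ C) (n : ℕ) :
    runningMax a n ≤ C := by
  induction n with
  | zero => exact hC
  | succ n ih => exact max_le ih (h _)

/-- Pathwise form of Doob's inequality, by summation by parts: a step that sets a new maximum leaves
the surplus (a (n+1) - max)^2, and any other step changes nothing. For a martingale the last sum has
mean zero. -/
theorem sq_runningMax_le {a : ℕ → ℝ} (n : ℕ) :
    runningMax a n ^ 2 ≤ 2 * (runningMax a n * a n)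
      - 2 * ∑ i ∈ Finset.range n, runningMax a i * (a (i + 1) - a i) := by
  induction n with
  | zero => simp [runningMax]
  | succ n ih =>
    rw [Finset.sum_range_succ]
    have h : runningMax a (n + 1) = max (runningMax a n) (a (n + 1)) := rfl
    rcases le_total (runningMax a n) (a (n + 1)) with h1 | h1
    · rw [max_eq_right h1] at h
      rw [h]
      nlinarith [sq_nonneg (a (n + 1) - runningMax a n)]
    · rw [max_eq_left h1] at h
      rw [h]
      nlinarith

theorem measurable_runningMax {Ω : Type*} {m : MeasurableSpace Ω} {M : ℕ → Ω → ℝ} {n : ℕ}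
    (h : ∀ i ≤ n, Measurable (M i)) : Measurable fun ω => runningMax (fun i => M i ω) n := by
  induction n with
  | zero => exact measurable_const
  | succ n ih => exact (ih fun i hi => h i (hi.trans n.le_succ)).max (h _ le_rfl)

section martingale

variable {Ω : Type*} [mΩ : MeasurableSpace Ω] {P : Measure Ω} [IsProbabilityMeasure P]
  {𝓕 : Filtration ℝ≥0 mΩ}

theorem integrable_of_measurable_of_bounded {f : Ω → ℝ} (hf : Measurable f)
    (hb : ∃ C, ∀ ω, |f ω| ≤ C) : Integrable f P := by
  obtain ⟨C, hC⟩ := hb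
  exact Integrable.of_bound hf.aestronglyMeasurable C (ae_of_all _ hC)

theorem integral_mul_martingale {M : ℝ≥0 → Ω → ℝ} (hM : Martingale M 𝓕 P) {s t : ℝ≥0} (hst : s ≤ t)
    {Y : Ω → ℝ} (hY : Measurable[𝓕 s] Y) (hb : ∃ C, ∀ ω, |Y ω| ≤ C) :
    ∫ ω, Y ω * M t ω ∂P = ∫ ω, Y ω * M s ω ∂P := by
  obtain ⟨C, hC⟩ := hb
  have h1 := condExp_stronglyMeasurable_mul_of_bound (μ := P) (𝓕.le s) hY.stronglyMeasurable
    (hM.integrable t) C (ae_of_all _ hC)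
  rw [← integral_condExp (𝓕.le s)]
  refine integral_congr_ae ?_
  filter_upwards [h1, hM.2 s t hst] with ω h1 h2
  have : (fun ω => Y ω * M t ω) = Y * M t := rfl
  rw [this, h1, Pi.mul_apply, h2]

theorem Martingale.integral_sq_runningMax_le {M : ℝ≥0 → Ω → ℝ} (hM : Martingale M 𝓕 P)
    {τ : ℕ → ℝ≥0} (hτ : Monotone τ) {C : ℝ} (hC : ∀ i ω, |M (τ i) ω| ≤ C) (n : ℕ) :
    ∫ ω, runningMax (fun i => M (τ i) ω) n ^ 2 ∂P ≤ 4 * ∫ ω, M (τ n) ω ^ 2 ∂P := by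
  obtain ⟨ω₀⟩ : Nonempty Ω := nonempty_of_isProbabilityMeasure P
  have hC0 : 0 ≤ C := (abs_nonneg _).trans (hC 0 ω₀)
  set m : ℕ → Ω → ℝ := fun n ω => runningMax (fun i => M (τ i) ω) n with hm
  have hMm : ∀ i, Measurable (M (τ i)) := fun i => ((hM.1 (τ i)).measurable).mono (𝓕.le _) le_rfl
  have hmF : ∀ n, Measurable[𝓕 (τ n)] (m n) := fun n =>
    measurable_runningMax (m := 𝓕 (τ n)) fun i hi =>
      ((hM.1 (τ i)).measurable).mono (𝓕.mono (hτ hi)) le_rfl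
  have hmm : ∀ n, Measurable (m n) := fun n => (hmF n).mono (𝓕.le _) le_rfl
  have hmb : ∀ n ω, |m n ω| ≤ C := fun n ω => by
    rw [abs_of_nonneg (runningMax_nonneg _ _)]
    exact runningMax_le hC0 (fun i => (le_abs_self _).trans (hC i ω)) n
  have hI : ∀ {f g : Ω → ℝ}, Measurable f → Measurable g → (∀ ω, |f ω| ≤ C) → (∀ ω, |g ω| ≤ C) →
      Integrable (fun ω => f ω * g ω) P := fun hf hg hfb hgb =>
    integrable_of_measurable_of_bounded (hf.mul hg) ⟨C * C, fun ω => by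
      rw [abs_mul]; exact mul_le_mul (hfb ω) (hgb ω) (abs_nonneg _) hC0⟩
  have hI2 : Integrable (fun ω => m n ω ^ 2) P := by
    simpa [sq] using hI (hmm n) (hmm n) (hmb n) (hmb n)
  have hI3 : Integrable (fun ω => M (τ n) ω ^ 2) P := by
    simpa [sq] using hI (hMm n) (hMm n) (hC n) (hC n)
  have hIi : ∀ i, Integrable (fun ω => m i ω * (M (τ (i + 1)) ω - M (τ i) ω)) P := fun i => by
    simp_rw [mul_sub]
    exact (hI (hmm i) (hMm _) (hmb i) (hC _)).sub (hI (hmm i) (hMm _) (hmb i) (hC _))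
  have h0 : ∀ i, ∫ ω, m i ω * (M (τ (i + 1)) ω - M (τ i) ω) ∂P = 0 := fun i => by
    simp_rw [mul_sub]
    rw [integral_sub (hI (hmm i) (hMm _) (hmb i) (hC _)) (hI (hmm i) (hMm _) (hmb i) (hC _)),
      integral_mul_martingale hM (hτ i.le_succ) (hmF i) ⟨C, hmb i⟩, sub_self]
  have hS : ∫ ω, ∑ i ∈ Finset.range n, m i ω * (M (τ (i + 1)) ω - M (τ i) ω) ∂P = 0 := by
    rw [integral_finsetSum _ fun i _ => hIi i]
    exact Finset.sum_eq_zero fun i _ => h0 i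
  -- Here 2 m M ≤ m²/2 + 2 M²; absorbing m²/2 on the left produces the constant 4.
  have hle : ∫ ω, m n ω ^ 2 ∂P ≤ ∫ ω, ((1 / 2) * m n ω ^ 2 + 2 * M (τ n) ω ^ 2
      - 2 * ∑ i ∈ Finset.range n, m i ω * (M (τ (i + 1)) ω - M (τ i) ω)) ∂P := by
    refine integral_mono hI2 (((hI2.const_mul _).add (hI3.const_mul _)).sub
      ((integrable_finsetSum _ fun i _ => hIi i).const_mul _)) fun ω => ?_
    have := sq_runningMax_le (a := fun i => M (τ i) ω) n
    simp only [hm]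
    nlinarith [sq_nonneg (runningMax (fun i => M (τ i) ω) n - 2 * M (τ n) ω)]
  have e : Integrable (fun ω => (1 / 2) * m n ω ^ 2 + 2 * M (τ n) ω ^ 2) P :=
    (hI2.const_mul _).add (hI3.const_mul _)
  rw [integral_sub e ((integrable_finsetSum _ fun i _ => hIi i).const_mul _),
    integral_add (hI2.const_mul _) (hI3.const_mul _), integral_const_mul, integral_const_mul,
    integral_const_mul, hS] at hle
  linarith

end martingale

/-! ### Bounded right-continuous processes and the second moment of their compensated versions. -/

/-- An adapted, uniformly bounded real process with right-continuous paths. -/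
structure IsBoundedRightContinuous {Ω : Type*} [mΩ : MeasurableSpace Ω]
    (𝓕 : Filtration ℝ≥0 mΩ) (Y : ℝ≥0 → Ω → ℝ) : Prop where
  adapted : ∀ t, Measurable[𝓕 t] (Y t)
  right_continuous : ∀ ω t, ContinuousWithinAt (fun s => Y s ω) (Set.Ici t) t
  bounded : ∃ C, ∀ t ω, |Y t ω| ≤ C

namespace IsBoundedRightContinuous

variable {Ω : Type*} [mΩ : MeasurableSpace Ω] {P : Measure Ω} [IsProbabilityMeasure P]
  {𝓕 : Filtration ℝ≥0 mΩ} {F g q : ℝ≥0 → Ω → ℝ}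

theorem measurable (hF : IsBoundedRightContinuous 𝓕 F) (t : ℝ≥0) : Measurable (F t) :=
  (hF.adapted t).mono (𝓕.le t) le_rfl

theorem measurable_uncurry (hF : IsBoundedRightContinuous 𝓕 F) :
    Measurable fun p : ℝ × Ω => F p.1.toNNReal p.2 :=
  measurable_uncurry_of_right_continuous hF.measurable hF.right_continuous

theorem integrable (hF : IsBoundedRightContinuous 𝓕 F) (t : ℝ≥0) : Integrable (F t) P :=
  integrable_of_measurable_of_bounded (hF.measurable t) (hF.bounded.imp fun _ h => h t)

theorem mul (hF : IsBoundedRightContinuous 𝓕 F) (hg : IsBoundedRightContinuous 𝓕 g) :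
    IsBoundedRightContinuous 𝓕 fun t ω => F t ω * g t ω where
  adapted t := (hF.adapted t).mul (hg.adapted t)
  right_continuous ω t := (hF.right_continuous ω t).mul (hg.right_continuous ω t)
  bounded := by
    obtain ⟨C, hC⟩ := hF.bounded
    obtain ⟨D, hD⟩ := hg.bounded
    refine ⟨C * D, fun t ω => ?_⟩
    rw [abs_mul]
    exact mul_le_mul (hC t ω) (hD t ω) (abs_nonneg _) ((abs_nonneg _).trans (hC t ω))

theorem sub (hF : IsBoundedRightContinuous 𝓕 F) (hg : IsBoundedRightContinuous 𝓕 g) :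
    IsBoundedRightContinuous 𝓕 fun t ω => F t ω - g t ω where
  adapted t := (hF.adapted t).sub (hg.adapted t)
  right_continuous ω t := (hF.right_continuous ω t).sub (hg.right_continuous ω t)
  bounded := by
    obtain ⟨C, hC⟩ := hF.bounded
    obtain ⟨D, hD⟩ := hg.bounded
    exact ⟨C + D, fun t ω => (abs_sub _ _).trans (add_le_add (hC t ω) (hD t ω))⟩

theorem const_mul (c : ℝ) (hF : IsBoundedRightContinuous 𝓕 F) :
    IsBoundedRightContinuous 𝓕 fun t ω => c * F t ω where
  adapted t := (hF.adapted t).const_mul c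
  right_continuous ω t := (hF.right_continuous ω t).const_mul c
  bounded := by
    obtain ⟨C, hC⟩ := hF.bounded
    refine ⟨|c| * C, fun t ω => ?_⟩
    rw [abs_mul]
    exact mul_le_mul_of_nonneg_left (hC t ω) (abs_nonneg _)

theorem sub_const (hF : IsBoundedRightContinuous 𝓕 F) (c : ℝ) :
    IsBoundedRightContinuous 𝓕 fun t ω => F t ω - c where
  adapted t := (hF.adapted t).sub_const c
  right_continuous ω t := (hF.right_continuous ω t).sub continuousWithinAt_const
  bounded := by
    obtain ⟨C, hC⟩ := hF.bounded
    exact ⟨C + |c|, fun t ω => (abs_sub _ _).trans (add_le_add (hC t ω) le_rfl)⟩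

theorem intervalIntegrable (hg : IsBoundedRightContinuous 𝓕 g) (ω : Ω) (a b : ℝ) :
    IntervalIntegrable (fun s => g s.toNNReal ω) volume a b := by
  obtain ⟨C, hC⟩ := hg.bounded
  have hm : Measurable fun s : ℝ => g s.toNNReal ω :=
    hg.measurable_uncurry.comp measurable_prodMk_right
  exact (intervalIntegrable_const (c := C)).mono_fun hm.aestronglyMeasurable
    (ae_of_all _ fun s => by
      rw [Real.norm_eq_abs]; exact (hC _ _).trans (le_abs_self _))

theorem abs_integral_le (hg : IsBoundedRightContinuous 𝓕 g) :
    ∃ C, 0 ≤ C ∧ ∀ (t : ℝ≥0) ω, |∫ s in (0 : ℝ)..t, g s.toNNReal ω| ≤ C * t := by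
  obtain ⟨C, hC⟩ := hg.bounded
  refine ⟨|C|, abs_nonneg _, fun t ω => ?_⟩
  have := intervalIntegral.norm_integral_le_of_norm_le_const (a := 0) (b := (t : ℝ)) (C := |C|)
    (f := fun s => g s.toNNReal ω) fun s _ => (hC _ _).trans (le_abs_self _)
  simpa using this

theorem continuous_integral (hg : IsBoundedRightContinuous 𝓕 g) (ω : Ω) :
    Continuous fun t : ℝ => ∫ s in (0 : ℝ)..t, g s.toNNReal ω :=
  intervalIntegral.continuous_primitive (fun a b => hg.intervalIntegrable ω a b) 0

/-- The chain rule for half the square of the primitive; as g is only right continuous, it is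
applied with right derivatives. -/
theorem integral_mul_primitive (hg : IsBoundedRightContinuous 𝓕 g) (ω : Ω) (t : ℝ≥0) :
    ∫ s in (0 : ℝ)..t, g s.toNNReal ω * ∫ r in (0 : ℝ)..s, g r.toNNReal ω
      = (∫ s in (0 : ℝ)..t, g s.toNNReal ω) ^ 2 / 2 := by
  have hcont := hg.continuous_integral ω
  have h := intervalIntegral.integral_eq_sub_of_hasDeriv_right (a := 0) (b := (t : ℝ))
    (f := fun u : ℝ => (∫ r in (0 : ℝ)..u, g r.toNNReal ω) ^ 2 / 2)
    (f' := fun u : ℝ => g u.toNNReal ω * ∫ r in (0 : ℝ)..u, g r.toNNReal ω)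
    ((hcont.pow 2).div_const 2).continuousOn ?_ ?_
  · rw [h]; simp
  · intro x _
    have hrc : ContinuousWithinAt (fun s : ℝ => g s.toNNReal ω) (Set.Ioi x) x := by
      refine ((hg.right_continuous ω x.toNNReal).comp
        continuous_real_toNNReal.continuousWithinAt fun y hy => ?_)
      exact Real.toNNReal_le_toNNReal (le_of_lt hy)
    have hd : HasDerivWithinAt (fun u : ℝ => ∫ r in (0 : ℝ)..u, g r.toNNReal ω)
        (g x.toNNReal ω) (Set.Ioi x) x :=
      (intervalIntegral.integral_hasDerivWithinAt_right (hg.intervalIntegrable ω 0 x)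
        (s := Set.Ici x) (t := Set.Ioi x)
        ((hg.measurable_uncurry.comp measurable_prodMk_right).stronglyMeasurable.stronglyMeasurableAtFilter)
        hrc).Ioi_of_Ici
    refine ((hd.pow 2).div_const 2).congr_deriv ?_
    simp; ring
  · exact (hg.intervalIntegrable ω 0 t).mul_continuousOn hcont.continuousOn

theorem integral_integral_swap (hg : IsBoundedRightContinuous 𝓕 g) (t : ℝ≥0) :
    ∫ ω, (∫ s in (0 : ℝ)..t, g s.toNNReal ω) ∂P = ∫ s in (0 : ℝ)..t, (∫ ω, g s.toNNReal ω ∂P) := by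
  obtain ⟨C, hC⟩ := hg.bounded
  simp_rw [intervalIntegral.integral_of_le t.coe_nonneg]
  refine MeasureTheory.integral_integral_swap ?_
  exact Integrable.of_bound (hg.measurable_uncurry.comp measurable_swap).aestronglyMeasurable C
    (ae_of_all _ fun p => hC _ _)

end IsBoundedRightContinuous

theorem MeasureTheory.Integrable.fun_sub_of {Ω : Type*} [MeasurableSpace Ω] {P : Measure Ω}
    {f g : Ω → ℝ} (hf : Integrable f P) (hg : Integrable g P) :
    Integrable (fun ω => f ω - g ω) P :=
  hf.sub hg

/-- The process `F t - F 0 - ∫ s in 0..t, g s`. -/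
noncomputable def compensated {Ω : Type*} (F g : ℝ≥0 → Ω → ℝ) (t : ℝ≥0) (ω : Ω) : ℝ :=
  F t ω - F 0 ω - ∫ s in (0 : ℝ)..t, g s.toNNReal ω

theorem compensated_zero {Ω : Type*} (F g : ℝ≥0 → Ω → ℝ) (ω : Ω) : compensated F g 0 ω = 0 := by
  simp [compensated]

namespace IsBoundedRightContinuous

variable {Ω : Type*} [mΩ : MeasurableSpace Ω] {P : Measure Ω} [IsProbabilityMeasure P]
  {𝓕 : Filtration ℝ≥0 mΩ} {F g q : ℝ≥0 → Ω → ℝ}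

/-- Integration by parts in mean. Since g s is known at time s, it is orthogonal to the increment of
the martingale from s to t; integrating this over s and expanding the increment gives the identity.
-/
theorem integral_mul_primitive_eq (hF : IsBoundedRightContinuous 𝓕 F)
    (hg : IsBoundedRightContinuous 𝓕 g) (hM : Martingale (compensated F g) 𝓕 P) (t : ℝ≥0) :
    ∫ ω, F t ω * (∫ s in (0 : ℝ)..t, g s.toNNReal ω) ∂P
      = ∫ ω, (∫ s in (0 : ℝ)..t, g s.toNNReal ω * F s.toNNReal ω) ∂P
        + (∫ ω, (∫ s in (0 : ℝ)..t, g s.toNNReal ω) ^ 2 ∂P) / 2 := by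
  set A : ℝ≥0 → Ω → ℝ := fun t ω => ∫ s in (0 : ℝ)..t, g s.toNNReal ω with hA
  obtain ⟨C, hC0, hC⟩ := hg.abs_integral_le
  have hAm : ∀ s, Measurable[𝓕 s] (A s) := fun s => by
    have h1 : A s = fun ω => F s ω - F 0 ω - compensated F g s ω := by
      ext ω; simp [A, compensated]
    rw [h1]
    exact ((hF.adapted s).sub ((hF.adapted 0).mono (𝓕.mono s.2) le_rfl)).sub (hM.1 s).measurable
  have hAc : ∀ ω, Continuous fun s : ℝ≥0 => A s ω := fun ω =>
    (hg.continuous_integral ω).comp NNReal.continuous_coe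
  -- the increment of the martingale over `[min s t, t]`
  set D : ℝ≥0 → Ω → ℝ := fun s ω => F t ω - F s ω - A t ω + A (min s t) ω with hD
  have hDm : ∀ s, Measurable (D s) := fun s =>
    (((hF.measurable t).sub (hF.measurable s)).sub ((hAm t).mono (𝓕.le _) le_rfl)).add
      ((hAm _).mono (𝓕.le _) le_rfl)
  have hDc : ∀ ω s, ContinuousWithinAt (fun s => D s ω) (Set.Ici s) s := fun ω s =>
    ((continuousWithinAt_const.sub (hF.right_continuous ω s)).sub continuousWithinAt_const).add
      ((hAc ω).comp (continuous_id.min continuous_const)).continuousWithinAt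
  have hDu := measurable_uncurry_of_right_continuous hDm hDc
  obtain ⟨K, hK⟩ := hF.bounded
  obtain ⟨G, hG⟩ := hg.bounded
  -- The minimum in `D` makes this bound hold for all s, since the primitive is controlled only by a
  -- linear function of time.
  have hDb : ∀ s ω, |D s ω| ≤ K + K + C * t + C * t := fun s ω => by
    refine (abs_add_le _ _).trans (add_le_add ((abs_sub _ _).trans (add_le_add
      ((abs_sub _ _).trans (add_le_add (hK _ _) (hK _ _))) (hC _ _))) ((hC _ _).trans ?_))
    exact mul_le_mul_of_nonneg_left (NNReal.coe_le_coe.2 (min_le_right _ _)) hC0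
  have hzero : ∀ s ≤ t, ∫ ω, g s ω * D s ω ∂P = 0 := fun s hs => by
    have h1 : ∀ ω, g s ω * D s ω
        = g s ω * compensated F g t ω - g s ω * compensated F g s ω := fun ω => by
      simp only [D, A, compensated, min_eq_left hs]; ring
    have hi : ∀ r, Integrable (fun ω => g s ω * compensated F g r ω) P := fun r =>
      (hM.integrable r).bdd_mul (c := G) (hg.measurable s).aestronglyMeasurable
        (ae_of_all _ fun ω => hG s ω)
    simp_rw [h1]
    rw [integral_sub (hi t) (hi s), integral_mul_martingale hM hs (hg.adapted s) ⟨G, hG s⟩, sub_self]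
  have hswap : ∫ ω, (∫ s in (0 : ℝ)..t, g s.toNNReal ω * D s.toNNReal ω) ∂P = 0 := by
    simp_rw [intervalIntegral.integral_of_le t.coe_nonneg]
    rw [MeasureTheory.integral_integral_swap]
    · refine integral_eq_zero_of_ae ?_
      refine (ae_restrict_iff' measurableSet_Ioc).2 (ae_of_all _ fun s hs => ?_)
      exact hzero _ (Real.toNNReal_le_iff_le_coe.2 hs.2)
    · refine Integrable.of_bound
        ((hg.measurable_uncurry.mul hDu).comp measurable_swap).aestronglyMeasurable
        (G * (K + K + C * t + C * t)) (ae_of_all _ fun p => ?_)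
      simp only [Function.uncurry, norm_mul, Real.norm_eq_abs]
      exact mul_le_mul (hG _ _) (hDb _ _) (abs_nonneg _) ((abs_nonneg _).trans (hG 0 p.1))
  have hpath : ∀ ω, ∫ s in (0 : ℝ)..t, g s.toNNReal ω * D s.toNNReal ω
      = F t ω * A t ω - (∫ s in (0 : ℝ)..t, g s.toNNReal ω * F s.toNNReal ω)
        - A t ω ^ 2 / 2 := fun ω => by
    have h1 : ∫ s in (0 : ℝ)..t, g s.toNNReal ω * D s.toNNReal ω
        = ∫ s in (0 : ℝ)..t, ((F t ω - A t ω) * g s.toNNReal ω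
          - g s.toNNReal ω * F s.toNNReal ω
          + g s.toNNReal ω * ∫ r in (0 : ℝ)..s, g r.toNNReal ω) := by
      refine intervalIntegral.integral_congr fun s hs => ?_
      rw [Set.uIcc_of_le t.coe_nonneg] at hs
      have h2 : min s.toNNReal t = s.toNNReal :=
        min_eq_left (Real.toNNReal_le_iff_le_coe.2 hs.2)
      simp only [D, A, h2, Real.coe_toNNReal s hs.1]
      ring
    have i1 := (hg.intervalIntegrable ω 0 t).const_mul (F t ω - A t ω)
    have i2 := (hg.mul hF).intervalIntegrable ω 0 t
    have i3 := (hg.intervalIntegrable ω 0 t).mul_continuousOn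
      (hg.continuous_integral ω).continuousOn
    rw [h1, intervalIntegral.integral_add (i1.sub i2) i3, intervalIntegral.integral_sub i1 i2,
      intervalIntegral.integral_const_mul, hg.integral_mul_primitive]
    simp only [A]
    ring
  have hAmeas : Measurable (A t) := (hAm t).mono (𝓕.le _) le_rfl
  have I1 : Integrable (fun ω => F t ω * A t ω) P :=
    (integrable_of_measurable_of_bounded hAmeas ⟨_, hC t⟩).bdd_mul (c := K)
      (hF.measurable t).aestronglyMeasurable (ae_of_all _ fun ω => hK t ω)
  have I3 : Integrable (fun ω => A t ω ^ 2) P := by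
    have := (integrable_of_measurable_of_bounded (P := P) hAmeas ⟨_, hC t⟩).bdd_mul (c := C * t)
      hAmeas.aestronglyMeasurable (ae_of_all _ fun ω => hC t ω)
    simpa [sq] using this
  have I2 : Integrable (fun ω => ∫ s in (0 : ℝ)..t, g s.toNNReal ω * F s.toNNReal ω) P := by
    obtain ⟨B, -, hB⟩ := (hg.mul hF).abs_integral_le
    refine integrable_of_measurable_of_bounded ?_ ⟨_, hB t⟩
    simp_rw [intervalIntegral.integral_of_le t.coe_nonneg]
    exact ((hg.mul hF).measurable_uncurry.comp
      measurable_swap).stronglyMeasurable.integral_prod_right'.measurable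
  simp_rw [hpath] at hswap
  rw [integral_sub (I1.fun_sub_of I2) (I3.div_const 2), integral_sub I1 I2, integral_div] at hswap
  linarith

theorem measurable_primitive (hg : IsBoundedRightContinuous 𝓕 g) (t : ℝ≥0) :
    Measurable fun ω => ∫ s in (0 : ℝ)..t, g s.toNNReal ω := by
  simp_rw [intervalIntegral.integral_of_le t.coe_nonneg]
  exact (hg.measurable_uncurry.comp
    measurable_swap).stronglyMeasurable.integral_prod_right'.measurable

theorem integrable_primitive (hg : IsBoundedRightContinuous 𝓕 g) (t : ℝ≥0) :
    Integrable (fun ω => ∫ s in (0 : ℝ)..t, g s.toNNReal ω) P := by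
  obtain ⟨C, -, hC⟩ := hg.abs_integral_le
  exact integrable_of_measurable_of_bounded (hg.measurable_primitive t) ⟨_, hC t⟩

theorem integral_compensated (hF : IsBoundedRightContinuous 𝓕 F)
    (hg : IsBoundedRightContinuous 𝓕 g) (hM : Martingale (compensated F g) 𝓕 P) (t : ℝ≥0) :
    ∫ ω, F t ω ∂P = ∫ ω, F 0 ω ∂P + ∫ ω, (∫ s in (0 : ℝ)..t, g s.toNNReal ω) ∂P := by
  have h1 : ∫ ω, compensated F g t ω ∂P = 0 := by
    have := integral_mul_martingale hM (zero_le : (0 : ℝ≥0) ≤ t) (Y := fun _ => 1) measurable_const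
      ⟨1, by simp⟩
    simpa [compensated_zero] using this
  simp only [compensated] at h1
  rw [integral_sub ((hF.integrable t).fun_sub_of (hF.integrable 0)) (hg.integrable_primitive t),
    integral_sub (hF.integrable t) (hF.integrable 0)] at h1
  linarith

theorem integral_zero_mul (hF : IsBoundedRightContinuous 𝓕 F)
    (hg : IsBoundedRightContinuous 𝓕 g) (hM : Martingale (compensated F g) 𝓕 P) (t : ℝ≥0) :
    ∫ ω, F 0 ω * F t ω ∂P = ∫ ω, F 0 ω ^ 2 ∂P
      + ∫ ω, F 0 ω * (∫ s in (0 : ℝ)..t, g s.toNNReal ω) ∂P := by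
  obtain ⟨K, hK⟩ := hF.bounded
  have h1 : ∫ ω, F 0 ω * compensated F g t ω ∂P = 0 := by
    have := integral_mul_martingale hM (zero_le : (0 : ℝ≥0) ≤ t) (hF.adapted 0) ⟨K, hK 0⟩
    simpa [compensated_zero] using this
  have hi : ∀ {f : Ω → ℝ}, Integrable f P → Integrable (fun ω => F 0 ω * f ω) P := fun hf =>
    hf.bdd_mul (c := K) (hF.measurable 0).aestronglyMeasurable (ae_of_all _ fun ω => hK 0 ω)
  simp only [compensated, mul_sub] at h1
  rw [integral_sub ((hi (hF.integrable t)).fun_sub_of (hi (hF.integrable 0)))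
    (hi (hg.integrable_primitive t)),
    integral_sub (hi (hF.integrable t)) (hi (hF.integrable 0))] at h1
  simp only [sq]
  linarith

/-- This identifies q - 2 F g as the density of the bracket without any stochastic calculus: the
square is expanded, and each cross term is evaluated by the martingale property of F or of its
square. -/
theorem integral_sq_compensated (hF : IsBoundedRightContinuous 𝓕 F)
    (hg : IsBoundedRightContinuous 𝓕 g) (hq : IsBoundedRightContinuous 𝓕 q)
    (hM : Martingale (compensated F g) 𝓕 P)
    (hQ : Martingale (compensated (fun t ω => F t ω * F t ω) q) 𝓕 P) (t : ℝ≥0) :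
    ∫ ω, compensated F g t ω ^ 2 ∂P
      = ∫ ω, (∫ s in (0 : ℝ)..t, (q s.toNNReal ω - 2 * (F s.toNNReal ω * g s.toNNReal ω))) ∂P := by
  have e1 := integral_mul_primitive_eq hF hg hM t
  have e2 := integral_compensated (hF.mul hF) hq hQ t
  have e3 := integral_zero_mul hF hg hM t
  obtain ⟨K, hK⟩ := hF.bounded
  obtain ⟨C, -, hC⟩ := hg.abs_integral_le
  set A : Ω → ℝ := fun ω => ∫ s in (0 : ℝ)..t, g s.toNNReal ω with hA
  have hi : ∀ {f : Ω → ℝ} s, Integrable f P → Integrable (fun ω => F s ω * f ω) P := fun s hf =>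
    hf.bdd_mul (c := K) (hF.measurable s).aestronglyMeasurable (ae_of_all _ fun ω => hK s ω)
  have iA : Integrable A P := hg.integrable_primitive t
  have iAA : Integrable (fun ω => A ω * A ω) P := iA.bdd_mul (c := C * t)
      (hg.measurable_primitive t).aestronglyMeasurable (ae_of_all _ fun ω => hC t ω)
  have h1 : ∀ ω, compensated F g t ω ^ 2 = F t ω * F t ω + F 0 ω * F 0 ω + A ω * A ω
      - 2 * (F 0 ω * F t ω) - 2 * (F t ω * A ω) + 2 * (F 0 ω * A ω) := fun ω => by
    simp only [compensated, A]; ring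
  have h2 : ∀ ω, ∫ s in (0 : ℝ)..t, (q s.toNNReal ω - 2 * (F s.toNNReal ω * g s.toNNReal ω))
      = (∫ s in (0 : ℝ)..t, q s.toNNReal ω)
        - 2 * ∫ s in (0 : ℝ)..t, g s.toNNReal ω * F s.toNNReal ω := fun ω => by
    rw [intervalIntegral.integral_sub (hq.intervalIntegrable ω 0 t)
      (((hF.mul hg).intervalIntegrable ω 0 t).const_mul 2), intervalIntegral.integral_const_mul]
    simp_rw [mul_comm (F _ ω)]
  have iF := hF.integrable (P := P)
  have j1 := hi t (iF t)
  have j2 := hi 0 (iF 0)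
  have j3 := (hi 0 (iF t)).const_mul 2
  have j4 := (hi t iA).const_mul 2
  have j5 := (hi 0 iA).const_mul 2
  simp_rw [h1, h2]
  rw [integral_add ((((j1.fun_add j2).fun_add iAA).fun_sub_of j3).fun_sub_of j4) j5,
    integral_sub (((j1.fun_add j2).fun_add iAA).fun_sub_of j3) j4, integral_sub ((j1.fun_add j2).fun_add iAA) j3,
    integral_add (j1.fun_add j2) iAA, integral_add j1 j2, integral_const_mul, integral_const_mul,
    integral_const_mul, integral_sub (hq.integrable_primitive t)
      (((hg.mul hF).integrable_primitive t).const_mul 2), integral_const_mul]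
  simp only [sq] at e1 e3
  linarith

end IsBoundedRightContinuous

/-! ### The maximal inequality in continuous time. -/

theorem ofReal_integral_le_lintegral_ofReal {Ω : Type*} [MeasurableSpace Ω] {μ : Measure Ω}
    (f : Ω → ℝ) : ENNReal.ofReal (∫ x, f x ∂μ) ≤ ∫⁻ x, ENNReal.ofReal (f x) ∂μ := by
  by_cases hf : Integrable f μ
  · have h1 : ∫ x, f x ∂μ ≤ ∫ x, max (f x) 0 ∂μ :=
      integral_mono hf hf.pos_part fun x => le_max_left _ _
    refine (ENNReal.ofReal_le_ofReal h1).trans ?_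
    rw [ofReal_integral_eq_lintegral_ofReal hf.pos_part (ae_of_all _ fun x => le_max_right _ _)]
    exact lintegral_mono fun x => by
      simp [ENNReal.ofReal_max]
  · simp [integral_undef hf]

namespace IsBoundedRightContinuous

variable {Ω : Type*} [mΩ : MeasurableSpace Ω] {P : Measure Ω} [IsProbabilityMeasure P]
  {𝓕 : Filtration ℝ≥0 mΩ} {F g q : ℝ≥0 → Ω → ℝ}

theorem ofReal_integral_primitive_le (hg : IsBoundedRightContinuous 𝓕 g) (t : ℝ≥0) :
    ENNReal.ofReal (∫ ω, (∫ s in (0 : ℝ)..t, g s.toNNReal ω) ∂P)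
      ≤ ∫⁻ s in Set.Ioc (0 : ℝ) t, ∫⁻ ω, ENNReal.ofReal (g s.toNNReal ω) ∂P := by
  rw [hg.integral_integral_swap, intervalIntegral.integral_of_le t.coe_nonneg]
  exact (ofReal_integral_le_lintegral_ofReal _).trans
    (lintegral_mono fun s => ofReal_integral_le_lintegral_ofReal _)

/-- Cauchy–Schwarz, obtained from the nonnegativity of the integral of (g - mean of g)² over [0, s].
-/
theorem sq_primitive_le (hg : IsBoundedRightContinuous 𝓕 g) (ω : Ω) {s t : ℝ≥0} (hst : s ≤ t) :
    (∫ r in (0 : ℝ)..s, g r.toNNReal ω) ^ 2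
      ≤ t * ∫ r in (0 : ℝ)..t, g r.toNNReal ω * g r.toNNReal ω := by
  have hgg := (hg.mul hg).intervalIntegrable ω
  have h1 : ∫ r in (0 : ℝ)..s, g r.toNNReal ω * g r.toNNReal ω
      ≤ ∫ r in (0 : ℝ)..t, g r.toNNReal ω * g r.toNNReal ω :=
    intervalIntegral.integral_mono_interval le_rfl s.coe_nonneg (NNReal.coe_le_coe.2 hst)
      (ae_of_all _ fun r => mul_self_nonneg _) (hgg 0 t)
  have h2 : (0 : ℝ) ≤ ∫ r in (0 : ℝ)..s, g r.toNNReal ω * g r.toNNReal ω :=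
    intervalIntegral.integral_nonneg s.coe_nonneg fun r _ => mul_self_nonneg _
  refine le_trans ?_ (mul_le_mul (NNReal.coe_le_coe.2 hst) h1 h2 t.coe_nonneg)
  rcases eq_or_lt_of_le s.coe_nonneg with h0 | h0
  · simp [← h0]
  set A := ∫ r in (0 : ℝ)..s, g r.toNNReal ω with hA
  have h3 : (0 : ℝ) ≤ ∫ r in (0 : ℝ)..s, (g r.toNNReal ω - A / s) ^ 2 :=
    intervalIntegral.integral_nonneg s.coe_nonneg fun r _ => sq_nonneg _
  have h4 : ∫ r in (0 : ℝ)..s, (g r.toNNReal ω - A / s) ^ 2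
      = (∫ r in (0 : ℝ)..s, g r.toNNReal ω * g r.toNNReal ω) - A ^ 2 / s := by
    have e : ∀ r : ℝ, (g r.toNNReal ω - A / s) ^ 2
        = g r.toNNReal ω * g r.toNNReal ω - 2 * (A / s) * g r.toNNReal ω + (A / s) ^ 2 :=
      fun r => by ring
    simp_rw [e]
    have i2 := (hg.intervalIntegrable ω 0 s).const_mul (2 * (A / s))
    rw [intervalIntegral.integral_add ((hgg 0 s).sub i2) intervalIntegrable_const,
      intervalIntegral.integral_sub (hgg 0 s) i2, intervalIntegral.integral_const_mul,
      intervalIntegral.integral_const, ← hA, smul_eq_mul]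
    field_simp
    ring
  rw [h4, sub_nonneg, div_le_iff₀ h0] at h3
  linarith

theorem exists_abs_compensated_le (hF : IsBoundedRightContinuous 𝓕 F)
    (hg : IsBoundedRightContinuous 𝓕 g) (t : ℝ≥0) :
    ∃ C, ∀ s ≤ t, ∀ ω, |compensated F g s ω| ≤ C := by
  obtain ⟨K, hK⟩ := hF.bounded
  obtain ⟨C, hC0, hC⟩ := hg.abs_integral_le
  refine ⟨K + K + C * t, fun s hs ω => (abs_sub _ _).trans (add_le_add
    ((abs_sub _ _).trans (add_le_add (hK _ _) (hK _ _))) ((hC s ω).trans ?_))⟩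
  exact mul_le_mul_of_nonneg_left (NNReal.coe_le_coe.2 hs) hC0

theorem lintegral_grid_le (hF : IsBoundedRightContinuous 𝓕 F)
    (hg : IsBoundedRightContinuous 𝓕 g) (hq : IsBoundedRightContinuous 𝓕 q)
    (hM : Martingale (compensated F g) 𝓕 P)
    (hQ : Martingale (compensated (fun t ω => F t ω * F t ω) q) 𝓕 P) (c : ℝ) (t : ℝ≥0)
    {τ : ℕ → ℝ≥0} (hτ : Monotone τ) (h0 : τ 0 = 0) (hτt : ∀ i, τ i ≤ t) {n : ℕ} (hn : τ n = t) :
    ∫⁻ ω, ⨆ j ∈ Finset.range (n + 1), ENNReal.ofReal ((F (τ j) ω - c) ^ 2) ∂P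
      ≤ 3 * ∫⁻ ω, ENNReal.ofReal ((F 0 ω - c) ^ 2) ∂P
        + 3 * t * (∫⁻ s in Set.Ioc (0 : ℝ) t, ∫⁻ ω, ENNReal.ofReal (g s.toNNReal ω ^ 2) ∂P)
        + 24 * ∫⁻ s in Set.Ioc (0 : ℝ) t,
            ∫⁻ ω, ENNReal.ofReal (q s.toNNReal ω - 2 * (F s.toNNReal ω * g s.toNNReal ω)) ∂P := by
  obtain ⟨C, hC⟩ := hF.exists_abs_compensated_le hg t
  have hMn : Martingale (-compensated F g) 𝓕 P := hM.neg
  set M := compensated F g with hMdef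
  have hMz : ∀ ω, M (τ 0) ω = 0 := fun ω => by rw [h0]; exact compensated_zero F g ω
  have hMm : ∀ s, Measurable (M s) := fun s => ((hM.1 s).measurable).mono (𝓕.le _) le_rfl
  set u : Ω → ℝ := fun ω => runningMax (fun i => M (τ i) ω) n with hu
  set v : Ω → ℝ := fun ω => runningMax (fun i => (-M) (τ i) ω) n with hv
  have hC0 : ∀ ω, 0 ≤ C := fun ω => (abs_nonneg _).trans (hC 0 zero_le ω)
  have hub : ∀ ω, |u ω| ≤ C := fun ω => by
    rw [abs_of_nonneg (runningMax_nonneg _ _)]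
    exact runningMax_le (hC0 ω) (fun i => (le_abs_self _).trans (hC _ (hτt i) ω)) n
  have hvb : ∀ ω, |v ω| ≤ C := fun ω => by
    rw [abs_of_nonneg (runningMax_nonneg _ _)]
    exact runningMax_le (hC0 ω) (fun i => (neg_le_abs _).trans (hC _ (hτt i) ω)) n
  have hum : Measurable u := measurable_runningMax fun i _ => hMm _
  have hvm : Measurable v := measurable_runningMax fun i _ => (hMm _).neg
  have hsq : ∀ {f : Ω → ℝ}, Measurable f → (∃ C, ∀ ω, |f ω| ≤ C) →
      Integrable (fun ω => f ω ^ 2) P := fun {f} hf hb => by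
    obtain ⟨C, hC⟩ := hb
    refine integrable_of_measurable_of_bounded (hf.pow_const 2) ⟨C ^ 2, fun ω => ?_⟩
    rw [abs_pow]
    exact pow_le_pow_left₀ (abs_nonneg _) (hC ω) 2
  have iu := hsq hum ⟨C, hub⟩
  have iv := hsq hvm ⟨C, hvb⟩
  have iF : Integrable (fun ω => (F 0 ω - c) ^ 2) P :=
    hsq ((hF.sub_const c).measurable 0) ((hF.sub_const c).bounded.imp fun _ h => h 0)
  have ig := (hg.mul hg).integrable_primitive (P := P) t
  have hDu : ∫ ω, u ω ^ 2 ∂P ≤ 4 * ∫ ω, M t ω ^ 2 ∂P := by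
    have := Martingale.integral_sq_runningMax_le hM hτ (fun i ω => hC _ (hτt i) ω) n
    rwa [hn] at this
  have hDv : ∫ ω, v ω ^ 2 ∂P ≤ 4 * ∫ ω, M t ω ^ 2 ∂P := by
    have := Martingale.integral_sq_runningMax_le hMn hτ (C := C)
      (fun i ω => by simpa using hC _ (hτt i) ω) n
    simpa [hn, hv] using this
  -- A majorant common to all grid times: the factor 3 comes from squaring initial value + primitive
  -- + martingale. The running maxima of M and of -M together dominate |M|, and Doob for both gives
  -- 24 = 3 (4 + 4).
  set H : Ω → ℝ := fun ω => 3 * (F 0 ω - c) ^ 2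
    + 3 * t * (∫ s in (0 : ℝ)..t, g s.toNNReal ω * g s.toNNReal ω)
    + 3 * (u ω ^ 2 + v ω ^ 2) with hH
  have hle : ∀ ω, ∀ j ∈ Finset.range (n + 1), (F (τ j) ω - c) ^ 2 ≤ H ω := fun ω j hj => by
    have hjn : j ≤ n := Nat.lt_succ_iff.1 (Finset.mem_range.1 hj)
    have e1 : M (τ j) ω ^ 2 ≤ u ω ^ 2 + v ω ^ 2 := by
      rcases le_total 0 (M (τ j) ω) with h | h
      · have := le_runningMax (a := fun i => M (τ i) ω) (hMz ω) hjn
        nlinarith [pow_le_pow_left₀ h this 2, sq_nonneg (v ω)]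
      · have := le_runningMax (a := fun i => (-M) (τ i) ω) (by simp [hMz]) hjn
        nlinarith [pow_le_pow_left₀ (neg_nonneg.2 h) this 2, sq_nonneg (u ω)]
    have e2 := hg.sq_primitive_le ω (hτt j)
    have e3 : F (τ j) ω - c = (F 0 ω - c) + (∫ r in (0 : ℝ)..(τ j), g r.toNNReal ω) + M (τ j) ω := by
      simp only [hMdef, compensated]; ring
    rw [e3, hH]
    set x := F 0 ω - c
    set y := ∫ r in (0 : ℝ)..(τ j), g r.toNNReal ω
    set z := M (τ j) ω
    nlinarith [sq_nonneg (x - y), sq_nonneg (x - z), sq_nonneg (y - z)]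
  have hH0 : ∀ ω, 0 ≤ H ω := fun ω =>
    (sq_nonneg _).trans (hle ω 0 (Finset.mem_range.2 n.succ_pos))
  have iH : Integrable H P :=
    ((iF.const_mul 3).fun_add (ig.const_mul (3 * t))).fun_add ((iu.fun_add iv).const_mul 3)
  calc ∫⁻ ω, ⨆ j ∈ Finset.range (n + 1), ENNReal.ofReal ((F (τ j) ω - c) ^ 2) ∂P
      ≤ ∫⁻ ω, ENNReal.ofReal (H ω) ∂P := lintegral_mono fun ω =>
        iSup₂_le fun j hj => ENNReal.ofReal_le_ofReal (hle ω j hj)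
    _ = ENNReal.ofReal (∫ ω, H ω ∂P) :=
        (ofReal_integral_eq_lintegral_ofReal iH (ae_of_all _ hH0)).symm
    _ ≤ ENNReal.ofReal (3 * ∫ ω, (F 0 ω - c) ^ 2 ∂P
          + 3 * t * ∫ ω, (∫ s in (0 : ℝ)..t, g s.toNNReal ω * g s.toNNReal ω) ∂P
          + 24 * ∫ ω, M t ω ^ 2 ∂P) := by
        refine ENNReal.ofReal_le_ofReal ?_
        rw [hH, integral_add ((iF.const_mul 3).fun_add (ig.const_mul (3 * t)))
          ((iu.fun_add iv).const_mul 3), integral_add (iF.const_mul 3) (ig.const_mul (3 * t)),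
          integral_const_mul, integral_const_mul, integral_const_mul, integral_add iu iv]
        linarith
    _ ≤ _ := by
        refine ENNReal.ofReal_add_le.trans (add_le_add (ENNReal.ofReal_add_le.trans
          (add_le_add ?_ ?_)) ?_)
        · rw [ENNReal.ofReal_mul (by norm_num)]
          refine mul_le_mul' (by simp) (ofReal_integral_le_lintegral_ofReal _)
        · rw [ENNReal.ofReal_mul (by positivity), ENNReal.ofReal_mul (by norm_num),
            ENNReal.ofReal_coe_nnreal]
          refine mul_le_mul' (by simp) ((hg.mul hg).ofReal_integral_primitive_le t |>.trans_eq ?_)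
          simp_rw [sq]
        · rw [ENNReal.ofReal_mul (by norm_num), integral_sq_compensated hF hg hq hM hQ]
          exact mul_le_mul' (by simp)
            ((hq.sub ((hF.mul hg).const_mul 2)).ofReal_integral_primitive_le t)

/-- A maximal inequality for the solutions of a martingale problem. -/
theorem lintegral_iSup_sq_le (hF : IsBoundedRightContinuous 𝓕 F)
    (hg : IsBoundedRightContinuous 𝓕 g) (hq : IsBoundedRightContinuous 𝓕 q)
    (hM : Martingale (compensated F g) 𝓕 P)
    (hQ : Martingale (compensated (fun t ω => F t ω * F t ω) q) 𝓕 P) (c : ℝ) (t : ℝ≥0) :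
    ∃ S : Ω → ℝ≥0∞, Measurable S ∧
      (∀ ω, ∀ s ≤ t, ENNReal.ofReal ((F s ω - c) ^ 2) ≤ S ω) ∧
    ∫⁻ ω, S ω ∂P
      ≤ 3 * ∫⁻ ω, ENNReal.ofReal ((F 0 ω - c) ^ 2) ∂P
        + 3 * t * (∫⁻ s in Set.Ioc (0 : ℝ) t, ∫⁻ ω, ENNReal.ofReal (g s.toNNReal ω ^ 2) ∂P)
        + 24 * ∫⁻ s in Set.Ioc (0 : ℝ) t,
            ∫⁻ ω, ENNReal.ofReal (q s.toNNReal ω - 2 * (F s.toNNReal ω * g s.toNNReal ω)) ∂P := by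
  set τ : ℕ → ℕ → ℝ≥0 := fun n j => min ((j : ℝ≥0) / (n + 1)) t with hτ
  set κ : ℕ → ℕ := fun n => ⌈t * (n + 1)⌉₊ with hκ
  set U : ℕ → Ω → ℝ≥0∞ := fun n ω =>
    ⨆ j ∈ Finset.range (κ n + 1), ENNReal.ofReal ((F (τ n j) ω - c) ^ 2) with hU
  have hUm : ∀ n, Measurable (U n) := fun n => by
    refine Measurable.iSup fun j => Measurable.iSup fun _ => ?_
    exact (((hF.measurable _).sub_const c).pow_const 2).ennreal_ofReal
  -- The lower limit of the grid maxima is a measurable majorant of the uncountable supremum: each s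
  -- is a limit of grid points from the right. Fatou then transfers the grid bound.
  refine ⟨fun ω => liminf (fun n => U n ω) atTop, Measurable.liminf hUm, fun ω s hs => ?_, ?_⟩
  · have hj : ∀ n, ENNReal.ofReal ((F (τ n ⌈s * (n + 1)⌉₊) ω - c) ^ 2) ≤ U n ω := fun n => by
      refine le_iSup₂ (f := fun j (_ : j ∈ Finset.range (κ n + 1)) =>
        ENNReal.ofReal ((F (τ n j) ω - c) ^ 2)) ⌈s * (n + 1)⌉₊ ?_
      exact Finset.mem_range.2 (Nat.lt_succ_of_le (Nat.ceil_le_ceil (by gcongr)))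
    have hlim : Tendsto (fun n : ℕ => τ n ⌈s * (n + 1)⌉₊) atTop (𝓝[≥] s) := by
      refine tendsto_nhdsWithin_iff.2 ⟨?_, Eventually.of_forall fun n => ?_⟩
      · have h := tendsto_nat_ceil_mul_div_atTop (R := ℝ) (a := s) s.2
        have h' := h.comp (tendsto_natCast_atTop_atTop.comp (tendsto_add_atTop_nat 1))
        have h2 : Tendsto (fun n : ℕ => (⌈s * ((n : ℝ≥0) + 1)⌉₊ : ℝ≥0) / (n + 1)) atTop (𝓝 s) := by
          rw [← NNReal.tendsto_coe]
          refine h'.congr fun n => ?_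
          simp only [Function.comp, NNReal.coe_div, NNReal.coe_natCast, NNReal.coe_add,
            NNReal.coe_one, Nat.cast_add, Nat.cast_one]
          congr 2
        simpa [hτ, min_eq_left hs] using h2.min (tendsto_const_nhds (x := t))
      · refine le_min ?_ hs
        rw [le_div_iff₀ (by positivity)]
        exact Nat.le_ceil _
    have hFl := ((hF.right_continuous ω s).tendsto.comp hlim)
    have := (ENNReal.continuous_ofReal.tendsto _).comp ((hFl.sub_const c).pow 2)
    calc ENNReal.ofReal ((F s ω - c) ^ 2)
        = liminf (fun n : ℕ => ENNReal.ofReal ((F (τ n ⌈s * (n + 1)⌉₊) ω - c) ^ 2)) atTop :=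
          this.liminf_eq.symm
      _ ≤ _ := liminf_le_liminf (Eventually.of_forall hj)
  · refine (lintegral_liminf_le hUm).trans (liminf_le_of_frequently_le' (Frequently.of_forall ?_))
    intro n
    refine lintegral_grid_le hF hg hq hM hQ c t (τ := τ n) ?_ ?_ (fun i => min_le_right _ _) ?_
    · intro i j hij
      exact min_le_min (by gcongr) le_rfl
    · simp [hτ]
    · simp only [hτ, hκ]
      refine min_eq_right ?_
      rw [le_div_iff₀ (by positivity)]
      exact Nat.le_ceil _

end IsBoundedRightContinuous

/-! ### The generator acting on the tail and on its square. -/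

/-- Rate of increase under arrivals of a quantity that gains `h i` when a customer joins queue
`i`. -/
noncomputable def arrivalRate (α : ℝ) (L : ℕ) {N : ℕ} (x : Fin N → ℕ) (h : Fin N → ℝ) : ℝ :=
  (N : ℝ) * α *
      ((∑ S ∈ Finset.powersetCard L (Finset.univ : Finset (Fin N)),
          (∑ i ∈ shortestQueues x S, h i) / ((shortestQueues x S).card : ℝ))
        / (N.choose L : ℝ))

/-- Rate of increase under services of a quantity that gains `h i` when a customer leaves queue
`i`. -/
noncomputable def serviceRate (β : ℝ) {N : ℕ} (x : Fin N → ℕ) (h : Fin N → ℝ) : ℝ :=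
  β * ∑ i ∈ Finset.univ.filter (fun i => 0 < x i), h i

/-- The probability that `L` distinct queues chosen at random have length at least `k`. -/
noncomputable def choiceTail (L : ℕ) {N : ℕ} (x : Fin N → ℕ) (k : ℕ) : ℝ :=
  ((Finset.univ.filter fun i => k ≤ x i).card.choose L : ℝ) / (N.choose L : ℝ)

theorem networkGenerator_eq (α β : ℝ) (L N : ℕ) (f : (Fin N → ℕ) → ℝ) (x : Fin N → ℕ) :
    networkGenerator α β L N f x
      = arrivalRate α L x (fun i => f (Function.update x i (x i + 1)) - f x)
        + serviceRate β x (fun i => f (Function.update x i (x i - 1)) - f x) := rfl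

section rates

variable {N : ℕ} (x : Fin N → ℕ)

theorem arrivalRate_add (α : ℝ) (L : ℕ) (h₁ h₂ : Fin N → ℝ) :
    arrivalRate α L x (fun i => h₁ i + h₂ i) = arrivalRate α L x h₁ + arrivalRate α L x h₂ := by
  simp only [arrivalRate, Finset.sum_add_distrib, add_div, mul_add]

theorem arrivalRate_mul (α : ℝ) (L : ℕ) (c : ℝ) (h : Fin N → ℝ) :
    arrivalRate α L x (fun i => c * h i) = c * arrivalRate α L x h := by
  simp only [arrivalRate, ← Finset.mul_sum, mul_div_assoc]
  ring

theorem serviceRate_add (β : ℝ) (h₁ h₂ : Fin N → ℝ) :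
    serviceRate β x (fun i => h₁ i + h₂ i) = serviceRate β x h₁ + serviceRate β x h₂ := by
  simp only [serviceRate, Finset.sum_add_distrib, mul_add]

theorem serviceRate_mul (β : ℝ) (c : ℝ) (h : Fin N → ℝ) :
    serviceRate β x (fun i => c * h i) = c * serviceRate β x h := by
  simp only [serviceRate, ← Finset.mul_sum]
  ring

theorem abs_arrivalRate_le {α : ℝ} (hα : 0 ≤ α) (L : ℕ) {h : Fin N → ℝ} {C : ℝ} (hC0 : 0 ≤ C)
    (hC : ∀ i, |h i| ≤ C) : |arrivalRate α L x h| ≤ N * α * C := by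
  have h1 : ∀ S : Finset (Fin N),
      |(∑ i ∈ shortestQueues x S, h i) / ((shortestQueues x S).card : ℝ)| ≤ C := fun S => by
    rw [abs_div, Nat.abs_cast]
    refine div_le_of_le_mul₀ (Nat.cast_nonneg _) hC0 ?_
    refine (Finset.abs_sum_le_sum_abs _ _).trans ((Finset.sum_le_sum fun i _ => hC i).trans ?_)
    rw [Finset.sum_const, nsmul_eq_mul, mul_comm]
  have h2 : |∑ S ∈ Finset.powersetCard L (Finset.univ : Finset (Fin N)),
      (∑ i ∈ shortestQueues x S, h i) / ((shortestQueues x S).card : ℝ)|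
      ≤ C * (N.choose L : ℝ) := by
    refine (Finset.abs_sum_le_sum_abs _ _).trans ((Finset.sum_le_sum fun S _ => h1 S).trans ?_)
    rw [Finset.sum_const, Finset.card_powersetCard, Finset.card_univ, Fintype.card_fin,
      nsmul_eq_mul, mul_comm]
  rw [arrivalRate, abs_mul, abs_of_nonneg (by positivity : (0 : ℝ) ≤ N * α), abs_div, Nat.abs_cast]
  exact mul_le_mul_of_nonneg_left (div_le_of_le_mul₀ (Nat.cast_nonneg _) hC0 h2) (by positivity)

theorem abs_serviceRate_le {β : ℝ} (hβ : 0 ≤ β) {h : Fin N → ℝ} {C : ℝ} (hC0 : 0 ≤ C)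
    (hC : ∀ i, |h i| ≤ C) : |serviceRate β x h| ≤ β * (N * C) := by
  rw [serviceRate, abs_mul, abs_of_nonneg hβ]
  refine mul_le_mul_of_nonneg_left ?_ hβ
  refine (Finset.abs_sum_le_sum_abs _ _).trans ((Finset.sum_le_sum fun i _ => hC i).trans ?_)
  rw [Finset.sum_const, nsmul_eq_mul]
  refine mul_le_mul_of_nonneg_right (Nat.cast_le.2 ?_) hC0
  exact (Finset.card_le_univ _).trans_eq (Fintype.card_fin N)

theorem exists_abs_networkGenerator_le {α β : ℝ} (hα : 0 ≤ α) (hβ : 0 ≤ β) (L : ℕ)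
    {f : (Fin N → ℕ) → ℝ} (hf : ∃ C, ∀ x, |f x| ≤ C) :
    ∃ C, ∀ x, |networkGenerator α β L N f x| ≤ C := by
  obtain ⟨C, hC⟩ := hf
  have hC0 : 0 ≤ C := (abs_nonneg _).trans (hC 0)
  have hd : ∀ x y, |f x - f y| ≤ C + C := fun x y => (abs_sub _ _).trans (add_le_add (hC x) (hC y))
  refine ⟨N * α * (C + C) + β * (N * (C + C)), fun x => ?_⟩
  rw [networkGenerator_eq]
  exact (abs_add_le _ _).trans (add_le_add
    (abs_arrivalRate_le x hα L (by positivity) fun i => hd _ _)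
    (abs_serviceRate_le x hβ (by positivity) fun i => hd _ _))

/-- All shortest queues of a sample have the same length, so the tie-breaking rule drops out; what
remains is the indicator that the minimum over the sample equals k. -/
theorem sum_shortestQueues_div {S : Finset (Fin N)} (hS : S.Nonempty) (k : ℕ) :
    (∑ i ∈ shortestQueues x S, if x i = k then (1 : ℝ) else 0) / ((shortestQueues x S).card : ℝ)
      = (if ∀ j ∈ S, k ≤ x j then (1 : ℝ) else 0) - if ∀ j ∈ S, k + 1 ≤ x j then 1 else 0 := by
  obtain ⟨i₀, hi₀, hmin⟩ := S.exists_min_image x hS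
  have hmem : i₀ ∈ shortestQueues x S := Finset.mem_filter.2 ⟨hi₀, hmin⟩
  have hval : ∀ i ∈ shortestQueues x S, x i = x i₀ := fun i hi =>
    le_antisymm ((Finset.mem_filter.1 hi).2 i₀ hi₀) (hmin i (Finset.mem_filter.1 hi).1)
  have hcard : ((shortestQueues x S).card : ℝ) ≠ 0 :=
    Nat.cast_ne_zero.2 (Finset.card_ne_zero_of_mem hmem)
  have hall : ∀ m, (∀ j ∈ S, m ≤ x j) ↔ m ≤ x i₀ := fun m =>
    ⟨fun h => h i₀ hi₀, fun h j hj => h.trans (hmin j hj)⟩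
  rw [Finset.sum_congr rfl fun i hi => by rw [hval i hi], Finset.sum_const, nsmul_eq_mul,
    mul_div_cancel_left₀ _ hcard]
  simp only [hall]
  split_ifs <;> first | omega | norm_num

theorem sum_powersetCard_ite (L k : ℕ) :
    ∑ S ∈ Finset.powersetCard L (Finset.univ : Finset (Fin N)),
        (if ∀ j ∈ S, k ≤ x j then (1 : ℝ) else 0)
      = ((Finset.univ.filter fun i => k ≤ x i).card.choose L : ℝ) := by
  rw [Finset.sum_boole, ← Finset.card_powersetCard]
  congr 2
  ext S
  simp [Finset.mem_powersetCard, Finset.subset_iff, and_comm]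

theorem arrivalRate_ite (α : ℝ) {L : ℕ} (hL : 1 ≤ L) (k : ℕ) :
    arrivalRate α L x (fun i => if x i = k then 1 else 0)
      = N * α * (choiceTail L x k - choiceTail L x (k + 1)) := by
  have h1 : ∀ S ∈ Finset.powersetCard L (Finset.univ : Finset (Fin N)), S.Nonempty := fun S hS =>
    Finset.card_pos.1 (hL.trans_eq (Finset.mem_powersetCard.1 hS).2.symm)
  rw [arrivalRate, Finset.sum_congr rfl fun S hS => sum_shortestQueues_div x (h1 S hS) k,
    Finset.sum_sub_distrib, sum_powersetCard_ite, sum_powersetCard_ite, sub_div]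
  rfl

theorem serviceRate_ite (β : ℝ) (hN : 0 < N) (k : ℕ) :
    serviceRate β x (fun i => if x i = k + 1 then 1 else 0)
      = N * β * (tailFraction x (k + 1) - tailFraction x (k + 2)) := by
  have hN' : (N : ℝ) ≠ 0 := by positivity
  have h1 : ∑ i ∈ Finset.univ.filter (fun i => 0 < x i), (if x i = k + 1 then (1 : ℝ) else 0)
      = ((Finset.univ.filter fun i => k + 1 ≤ x i).card : ℝ)
        - ((Finset.univ.filter fun i => k + 2 ≤ x i).card : ℝ) := by
    rw [Finset.sum_filter, ← Finset.sum_boole, ← Finset.sum_boole, ← Finset.sum_sub_distrib]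
    refine Finset.sum_congr rfl fun i _ => ?_
    split_ifs <;> first | omega | norm_num
  rw [serviceRate, h1, tailFraction, tailFraction]
  field_simp

theorem tailFraction_eq_sum (k : ℕ) :
    tailFraction x k = (∑ i, if k ≤ x i then (1 : ℝ) else 0) / N := by
  rw [tailFraction, Finset.sum_boole]

theorem tailFraction_update_sub (i : Fin N) (m k : ℕ) :
    tailFraction (Function.update x i m) k - tailFraction x k
      = ((if k ≤ m then (1 : ℝ) else 0) - if k ≤ x i then 1 else 0) / N := by
  rw [tailFraction_eq_sum, tailFraction_eq_sum, ← sub_div, ← Finset.sum_sub_distrib,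
    Finset.sum_eq_single i]
  · simp
  · intro j _ hj
    simp [Function.update_of_ne hj]
  · simp

theorem tailFraction_arrival (i : Fin N) (k : ℕ) :
    tailFraction (Function.update x i (x i + 1)) (k + 1) - tailFraction x (k + 1)
      = (N : ℝ)⁻¹ * if x i = k then 1 else 0 := by
  rw [tailFraction_update_sub, div_eq_inv_mul]
  congr 1
  split_ifs <;> first | omega | norm_num

theorem tailFraction_service {i : Fin N} (hi : 0 < x i) (k : ℕ) :
    tailFraction (Function.update x i (x i - 1)) (k + 1) - tailFraction x (k + 1)
      = -(N : ℝ)⁻¹ * if x i = k + 1 then 1 else 0 := by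
  rw [tailFraction_update_sub, div_eq_inv_mul, neg_mul, ← mul_neg]
  congr 1
  split_ifs <;> first | omega | norm_num

theorem serviceRate_congr (β : ℝ) {h₁ h₂ : Fin N → ℝ} (h : ∀ i, 0 < x i → h₁ i = h₂ i) :
    serviceRate β x h₁ = serviceRate β x h₂ := by
  rw [serviceRate, serviceRate, Finset.sum_congr rfl fun i hi => h i (Finset.mem_filter.1 hi).2]

theorem networkGenerator_tailFraction (α β : ℝ) {L : ℕ} (hL : 1 ≤ L) (hN : 0 < N) (k : ℕ) :
    networkGenerator α β L N (fun x => tailFraction x (k + 1)) x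
      = α * (choiceTail L x k - choiceTail L x (k + 1))
        - β * (tailFraction x (k + 1) - tailFraction x (k + 2)) := by
  have hN' : (N : ℝ) ≠ 0 := by positivity
  rw [networkGenerator_eq]
  simp only [tailFraction_arrival]
  rw [arrivalRate_mul, arrivalRate_ite x α hL,
    serviceRate_congr x β fun i hi => tailFraction_service x hi k, serviceRate_mul,
    serviceRate_ite x β hN]
  field_simp
  ring

/-- The carré du champ: in a² - r² = (a - r)² + 2 r (a - r) the linear part cancels, and the squared
jumps are 1/N² at total rate of order N. -/
theorem networkGenerator_tailFraction_sq (α β : ℝ) {L : ℕ} (hL : 1 ≤ L) (hN : 0 < N) (k : ℕ) :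
    networkGenerator α β L N (fun x => tailFraction x (k + 1) * tailFraction x (k + 1)) x
        - 2 * (tailFraction x (k + 1)
          * networkGenerator α β L N (fun x => tailFraction x (k + 1)) x)
      = (α * (choiceTail L x k - choiceTail L x (k + 1))
        + β * (tailFraction x (k + 1) - tailFraction x (k + 2))) / N := by
  have hN' : (N : ℝ) ≠ 0 := by positivity
  set r := tailFraction x (k + 1) with hr
  have e : ∀ y : Fin N → ℕ, tailFraction y (k + 1) * tailFraction y (k + 1) - r * r
      = (tailFraction y (k + 1) - r) * (tailFraction y (k + 1) - r)
        + 2 * r * (tailFraction y (k + 1) - r) := fun y => by ring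
  rw [networkGenerator_eq, networkGenerator_eq]
  simp only [← hr, e]
  rw [arrivalRate_add, serviceRate_add, arrivalRate_mul x α L (2 * r), serviceRate_mul x β (2 * r)]
  have e1 : ∀ i, (tailFraction (Function.update x i (x i + 1)) (k + 1) - r)
      * (tailFraction (Function.update x i (x i + 1)) (k + 1) - r)
      = ((N : ℝ)⁻¹ * (N : ℝ)⁻¹) * if x i = k then 1 else 0 := fun i => by
    rw [hr, tailFraction_arrival]; split_ifs <;> simp
  have e2 : ∀ i, 0 < x i → (tailFraction (Function.update x i (x i - 1)) (k + 1) - r)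
      * (tailFraction (Function.update x i (x i - 1)) (k + 1) - r)
      = ((N : ℝ)⁻¹ * (N : ℝ)⁻¹) * if x i = k + 1 then 1 else 0 := fun i hi => by
    rw [hr, tailFraction_service x hi]; split_ifs <;> simp
  rw [serviceRate_congr x β e2]
  simp only [e1]
  rw [arrivalRate_mul x α L ((N : ℝ)⁻¹ * (N : ℝ)⁻¹), serviceRate_mul x β ((N : ℝ)⁻¹ * (N : ℝ)⁻¹),
    arrivalRate_ite x α hL, serviceRate_ite x β hN]
  field_simp
  ring

end rates

/-! ### Sampling without replacement, the stable point, and elementary bounds on tails. -/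

theorem choose_ratio_succ {n N L : ℕ} (hn : n ≤ N) (hLn : L ≤ n) :
    (n.choose (L + 1) : ℝ) / N.choose (L + 1)
      = (n.choose L : ℝ) / N.choose L * (((n : ℝ) - L) / ((N : ℝ) - L)) := by
  have h1 : ((n.choose (L + 1) : ℕ) : ℝ) * (L + 1) = n.choose L * ((n : ℝ) - L) := by
    rw [← Nat.cast_sub hLn]; exact_mod_cast Nat.choose_succ_right_eq n L
  have h2 : ((N.choose (L + 1) : ℕ) : ℝ) * (L + 1) = N.choose L * ((N : ℝ) - L) := by
    rw [← Nat.cast_sub (hLn.trans hn)]; exact_mod_cast Nat.choose_succ_right_eq N L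
  have h3 : (0 : ℝ) < L + 1 := by positivity
  rw [← mul_div_mul_right _ _ h3.ne', h1, h2, mul_div_mul_comm]

theorem choose_ratio_nonneg (n N L : ℕ) : (0 : ℝ) ≤ (n.choose L : ℝ) / N.choose L := by positivity

theorem choose_ratio_le {n N L : ℕ} (hL : 1 ≤ L) (hn : n ≤ N) (hN : L ≤ N) :
    (n.choose L : ℝ) / N.choose L ≤ (n : ℝ) / N := by
  induction L, hL using Nat.le_induction with
  | base => simp
  | succ L hL ih =>
    rcases lt_or_ge n L with h | h
    · rw [Nat.choose_eq_zero_of_lt (by omega)]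
      simp; positivity
    · rw [choose_ratio_succ hn h]
      refine (mul_le_of_le_one_right (choose_ratio_nonneg _ _ _) ?_).trans (ih (by omega))
      have h1 : (n : ℝ) ≤ N := Nat.cast_le.2 hn
      have h2 : (L : ℝ) + 1 ≤ N := by exact_mod_cast hN
      exact div_le_one_of_le₀ (by linarith) (by linarith)

/-- Sampling without replacement differs from sampling with replacement by a relative error of
order `1 / N`. -/
theorem exists_abs_choose_ratio_sub_pow_le {L : ℕ} (hL : 1 ≤ L) :
    ∃ c : ℝ, 0 ≤ c ∧ ∀ N n : ℕ, L ≤ N → n ≤ N →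
      |(n.choose L : ℝ) / N.choose L - ((n : ℝ) / N) ^ L| ≤ c / N * ((n : ℝ) / N) := by
  induction L, hL using Nat.le_induction with
  | base => exact ⟨0, le_rfl, fun N n _ _ => by simp⟩
  | succ L hL ih =>
    obtain ⟨c, hc0, hc⟩ := ih
    refine ⟨c + L * (L + 1), by positivity, fun N n hN hn => ?_⟩
    have hN0 : (0 : ℝ) < N := Nat.cast_pos.2 (by omega)
    have hnN : (n : ℝ) ≤ N := Nat.cast_le.2 hn
    have hr0 : (0 : ℝ) ≤ (n : ℝ) / N := by positivity
    have hr1 : (n : ℝ) / N ≤ 1 := div_le_one_of_le₀ hnN hN0.le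
    have hih := hc N n (by omega) hn
    set r : ℝ := (n : ℝ) / N with hr
    set a : ℝ := (n.choose L : ℝ) / N.choose L with ha
    rcases lt_or_ge n L with h | h
    · have ha0 : a = 0 := by rw [ha, Nat.choose_eq_zero_of_lt h]; simp
      rw [Nat.choose_eq_zero_of_lt (by omega : n < L + 1)]
      rw [ha0, zero_sub, abs_neg, abs_of_nonneg (by positivity)] at hih
      rw [Nat.cast_zero, zero_div, zero_sub, abs_neg, abs_of_nonneg (by positivity), pow_succ]
      refine (mul_le_of_le_one_right (by positivity) hr1).trans (hih.trans ?_)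
      gcongr
      nlinarith
    · have hLN : (L : ℝ) + 1 ≤ N := by exact_mod_cast hN
      have hd : (0 : ℝ) < (N : ℝ) - L := by linarith
      have hLn : (L : ℝ) ≤ n := Nat.cast_le.2 h
      rw [choose_ratio_succ hn h, ← ha]
      set q : ℝ := ((n : ℝ) - L) / ((N : ℝ) - L) with hq
      have hq0 : 0 ≤ q := div_nonneg (by linarith) hd.le
      have hq1 : q ≤ 1 := div_le_one_of_le₀ (by linarith) hd.le
      have hqr : |q - r| ≤ L * (L + 1) / N := by
        have e : q - r = -(L * ((N : ℝ) - n)) / (N * ((N : ℝ) - L)) := by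
          rw [hq, hr]; field_simp; ring
        rw [e, abs_div, abs_neg, abs_of_nonneg (mul_nonneg (Nat.cast_nonneg _) (by linarith)),
          abs_of_pos (by positivity), div_le_div_iff₀ (by positivity) hN0]
        -- (L + 1)(N - L) - N = L (N - L - 1) ≥ 0.
        have h1 : (N : ℝ) - n ≤ (L + 1) * ((N : ℝ) - L) := by nlinarith [(Nat.cast_nonneg L : (0:ℝ) ≤ L)]
        nlinarith [mul_le_mul_of_nonneg_left h1 (by positivity : (0 : ℝ) ≤ L * N)]
      have e : a * q - r ^ (L + 1) = (a - r ^ L) * q + r ^ L * (q - r) := by ring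
      rw [e]
      refine (abs_add_le _ _).trans ?_
      rw [abs_mul, abs_mul, abs_of_nonneg hq0, abs_of_nonneg (by positivity : 0 ≤ r ^ L)]
      have h1 : |a - r ^ L| * q ≤ c / N * r :=
        (mul_le_of_le_one_right (abs_nonneg _) hq1).trans hih
      have h2 : r ^ L * |q - r| ≤ r * (L * (L + 1) / N) :=
        mul_le_mul (pow_le_of_le_one hr0 hr1 (by omega)) hqr (abs_nonneg _) hr0
      calc |a - r ^ L| * q + r ^ L * |q - r| ≤ c / N * r + r * (L * (L + 1) / N) := add_le_add h1 h2
        _ = (c + L * (L + 1)) / N * r := by ring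

theorem stablePoint_zero (ρ : ℝ) (L : ℕ) : stablePoint ρ L 0 = 1 := by simp [stablePoint]

theorem stablePoint_succ (ρ : ℝ) (L k : ℕ) :
    stablePoint ρ L (k + 1) = ρ * stablePoint ρ L k ^ L := by
  rw [stablePoint, stablePoint, Finset.sum_range_succ', pow_zero, pow_succ, ← pow_mul,
    Finset.sum_mul, mul_comm]
  simp_rw [pow_succ]

theorem stablePoint_pos {ρ : ℝ} (hρ : 0 < ρ) (L k : ℕ) : 0 < stablePoint ρ L k := pow_pos hρ _

theorem stablePoint_le_one {ρ : ℝ} (hρ : 0 < ρ) (hρ1 : ρ ≤ 1) (L k : ℕ) : stablePoint ρ L k ≤ 1 :=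
  pow_le_one₀ hρ.le hρ1

theorem stablePoint_succ_le {ρ : ℝ} (hρ : 0 < ρ) (hρ1 : ρ ≤ 1) (L k : ℕ) :
    stablePoint ρ L (k + 1) ≤ stablePoint ρ L k :=
  pow_le_pow_of_le_one hρ.le hρ1 (by rw [Finset.sum_range_succ]; omega)

section tail

variable {N : ℕ} (x : Fin N → ℕ)

theorem card_tail_le (k : ℕ) : (Finset.univ.filter fun i => k ≤ x i).card ≤ N :=
  (Finset.card_le_univ _).trans_eq (Fintype.card_fin N)

theorem tailFraction_nonneg (k : ℕ) : 0 ≤ tailFraction x k := by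
  rw [tailFraction]; positivity

theorem tailFraction_le_one (k : ℕ) : tailFraction x k ≤ 1 :=
  div_le_one_of_le₀ (Nat.cast_le.2 (card_tail_le x k)) (Nat.cast_nonneg _)

theorem tailFraction_zero (hN : 0 < N) : tailFraction x 0 = 1 := by
  have : (N : ℝ) ≠ 0 := by positivity
  simp [tailFraction, this]

theorem choiceTail_nonneg (L k : ℕ) : 0 ≤ choiceTail L x k := choose_ratio_nonneg _ _ _

theorem choiceTail_le {L : ℕ} (hL : 1 ≤ L) (hN : L ≤ N) (k : ℕ) :
    choiceTail L x k ≤ tailFraction x k := choose_ratio_le hL (card_tail_le x k) hN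

theorem fluctuation_sq (ρ : ℝ) (L k : ℕ) :
    fluctuation ρ L x k ^ 2 = N * (tailFraction x k - stablePoint ρ L k) ^ 2 := by
  rw [fluctuation, mul_pow, Real.sq_sqrt (Nat.cast_nonneg _)]

theorem fluctuation_zero (ρ : ℝ) (L : ℕ) (hN : 0 < N) : fluctuation ρ L x 0 = 0 := by
  rw [fluctuation, tailFraction_zero x hN, stablePoint_zero, sub_self, mul_zero]

theorem fluctuation_sq_le {ρ : ℝ} (hρ : 0 < ρ) (hρ1 : ρ ≤ 1) (L k : ℕ) :
    fluctuation ρ L x k ^ 2 ≤ N := by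
  rw [fluctuation_sq]
  refine mul_le_of_le_one_right (Nat.cast_nonneg _) ?_
  rw [sq_le_one_iff_abs_le_one, abs_le]
  have h1 := tailFraction_nonneg x k
  have h2 := tailFraction_le_one x k
  have h3 := (stablePoint_pos hρ L k).le
  have h4 := stablePoint_le_one hρ hρ1 L k
  constructor <;> linarith

/-- A nonzero tail r is at least 1/N, so N r² ≥ r. If r > 3u then r - u ≥ 2r/3, whence N (r - u)² ≥
4r/9, and 5 · 4/9 > 1. This lets terms linear in r be absorbed into the squared norm plus a
deterministic term. -/
theorem tailFraction_le_fluctuation_sq {ρ : ℝ} (hρ : 0 < ρ) (L k : ℕ) :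
    tailFraction x k ≤ 5 * fluctuation ρ L x k ^ 2 + 3 * stablePoint ρ L k := by
  have hu := stablePoint_pos hρ L k
  rw [fluctuation_sq]
  set u := stablePoint ρ L k
  rcases le_or_gt (tailFraction x k) (3 * u) with h | h
  · have : (0 : ℝ) ≤ 5 * (N * (tailFraction x k - u) ^ 2) := by positivity
    linarith
  · have hr : 0 < tailFraction x k := by linarith
    have hN : (0 : ℝ) < N := by
      rcases Nat.eq_zero_or_pos N with h0 | h0
      · subst h0; simp [tailFraction] at hr
      · exact_mod_cast h0
    have h1 : 1 ≤ N * tailFraction x k := by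
      have e : N * tailFraction x k = ((Finset.univ.filter fun i => k ≤ x i).card : ℝ) := by
        rw [tailFraction]; field_simp
      have h2 : 0 < N * tailFraction x k := by positivity
      rw [e] at h2 ⊢
      exact_mod_cast h2
    have h2 : 2 / 3 * tailFraction x k ≤ tailFraction x k - u := by linarith
    have h3 : (2 / 3 * tailFraction x k) ^ 2 ≤ (tailFraction x k - u) ^ 2 :=
      pow_le_pow_left₀ (by positivity) h2 2
    have h4 := mul_le_mul_of_nonneg_left h3 hN.le
    nlinarith

end tail

theorem abs_pow_sub_pow_le_mul {a b : ℝ} (ha0 : 0 ≤ a) (ha : a ≤ 1) (hb0 : 0 ≤ b) (hb : b ≤ 1)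
    (L : ℕ) : |a ^ L - b ^ L| ≤ L * |a - b| := by
  induction L with
  | zero => simp
  | succ L ih =>
    have e : a ^ (L + 1) - b ^ (L + 1) = (a ^ L - b ^ L) * a + b ^ L * (a - b) := by ring
    rw [e]
    refine (abs_add_le _ _).trans ?_
    rw [abs_mul, abs_mul, abs_of_nonneg ha0, abs_of_nonneg (by positivity : 0 ≤ b ^ L)]
    have h1 := (mul_le_of_le_one_right (abs_nonneg (a ^ L - b ^ L)) ha).trans ih
    have h2 : b ^ L * |a - b| ≤ |a - b| := mul_le_of_le_one_left (abs_nonneg _) (pow_le_one₀ hb0 hb)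
    push_cast
    linarith

theorem sq_add_six_le (a b c d e f : ℝ) : (a - b + c - d - e + f) ^ 2
    ≤ 6 * (a ^ 2 + b ^ 2 + c ^ 2 + d ^ 2 + e ^ 2 + f ^ 2) := by
  have h := sq_sum_le_card_mul_sum_sq (s := Finset.univ) (f := ![a, -b, c, -d, -e, f])
  simp only [Fin.sum_univ_six, Finset.card_univ, Fintype.card_fin] at h
  simp at h
  linarith

/-! ### Drift and bracket of one coordinate, uniformly in N and in the level. -/

/-- The local energy of the fluctuations around level `k + 1`. -/
noncomputable def localEnergy (ρ : ℝ) (L : ℕ) {N : ℕ} (x : Fin N → ℕ) (k : ℕ) : ℝ :=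
  fluctuation ρ L x k ^ 2 + fluctuation ρ L x (k + 1) ^ 2 + fluctuation ρ L x (k + 2) ^ 2
    + stablePoint ρ L k

theorem exists_drift_and_bracket_le {α β : ℝ} (hα : 0 < α) (hαβ : α < β) {L : ℕ} (hL : 1 ≤ L) :
    ∃ K : ℝ≥0, ∀ N, L ≤ N → ∀ (x : Fin N → ℕ) (k : ℕ),
      N * networkGenerator α β L N (fun x => tailFraction x (k + 1)) x ^ 2
        ≤ K * localEnergy (α / β) L x k ∧
      N * (networkGenerator α β L N (fun x => tailFraction x (k + 1) * tailFraction x (k + 1)) x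
        - 2 * (tailFraction x (k + 1)
          * networkGenerator α β L N (fun x => tailFraction x (k + 1)) x))
        ≤ K * localEnergy (α / β) L x k := by
  have hβ : 0 < β := hα.trans hαβ
  have hρ : 0 < α / β := div_pos hα hβ
  have hρ1 : α / β ≤ 1 := (div_le_one hβ).2 hαβ.le
  obtain ⟨c, hc0, hc⟩ := exists_abs_choose_ratio_sub_pow_le hL
  -- The outer 6 is the number of terms in the drift; the inner 6 is 3 + 3, from 3u at two levels
  -- with u decreasing (it exceeds the 5 in front of the fluctuations). The last summand serves the
  -- bracket.
  refine ⟨(6 * (6 * α ^ 2 * c ^ 2 + α ^ 2 * L ^ 2 + β ^ 2) + 5 * (α + β)).toNNReal,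
    fun N hN x k => ?_⟩
  rw [Real.coe_toNNReal _ (by positivity)]
  have hN0 : 0 < N := by omega
  have hNr : (1 : ℝ) ≤ N := by exact_mod_cast hN0
  rw [networkGenerator_tailFraction_sq x α β hL hN0, networkGenerator_tailFraction x α β hL hN0,
    mul_div_cancel₀ _ (by positivity : (N : ℝ) ≠ 0), localEnergy]
  set ρ := α / β with hρdef
  have hu : ∀ j, 0 < stablePoint ρ L j := stablePoint_pos hρ L
  have hu1 := stablePoint_succ_le hρ hρ1 L k
  have hbal : ∀ j, α * stablePoint ρ L j ^ L = β * stablePoint ρ L (j + 1) := fun j => by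
    rw [stablePoint_succ, hρdef]; field_simp
  have hR := fun j => tailFraction_le_fluctuation_sq x hρ L j
  have hr0 := tailFraction_nonneg x
  have hr1 := tailFraction_le_one x
  have ha0 := choiceTail_nonneg x L
  have ha := choiceTail_le x hL hN
  -- the correction due to sampling without replacement
  have hA : ∀ j, N * (choiceTail L x j - tailFraction x j ^ L) ^ 2
      ≤ c ^ 2 * (5 * fluctuation ρ L x j ^ 2 + 3 * stablePoint ρ L j) := fun j => by
    have h1 : |choiceTail L x j - tailFraction x j ^ L| ≤ c / N * tailFraction x j :=
      hc N _ hN (card_tail_le x j)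
    have h2 := pow_le_pow_left₀ (abs_nonneg _) h1 2
    rw [sq_abs] at h2
    calc N * (choiceTail L x j - tailFraction x j ^ L) ^ 2 ≤ N * (c / N * tailFraction x j) ^ 2 := by
          gcongr
      _ = c ^ 2 * (tailFraction x j * (tailFraction x j / N)) := by field_simp
      _ ≤ c ^ 2 * tailFraction x j := by
          gcongr
          refine mul_le_of_le_one_right (hr0 j) (div_le_one_of_le₀ ?_ (by positivity))
          linarith [hr1 j]
      _ ≤ _ := by gcongr; exact hR j
  have hB : ∀ j, N * (tailFraction x j ^ L - stablePoint ρ L j ^ L) ^ 2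
      ≤ L ^ 2 * fluctuation ρ L x j ^ 2 := fun j => by
    have h1 := abs_pow_sub_pow_le_mul (hr0 j) (hr1 j) (hu j).le (stablePoint_le_one hρ hρ1 L j) L
    have h2 := pow_le_pow_left₀ (abs_nonneg _) h1 2
    rw [sq_abs, mul_pow, sq_abs] at h2
    rw [fluctuation_sq]
    nlinarith [mul_le_mul_of_nonneg_left h2 (by positivity : (0 : ℝ) ≤ N)]
  have hA0 := hA k
  have hA1 := hA (k + 1)
  have hB0 := hB k
  have hB1 := hB (k + 1)
  have hC1 := fluctuation_sq x ρ L (k + 1)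
  have hC2 := fluctuation_sq x ρ L (k + 2)
  have hz := fun j => sq_nonneg (fluctuation ρ L x j)
  have hz0 := hz k
  have hz1 := hz (k + 1)
  have hz2 := hz (k + 2)
  have hu0 := (hu k).le
  constructor
  -- The equilibrium balance is subtracted, leaving two sampling errors, two differences of L-th
  -- powers and two service differences.
  · have e : α * (choiceTail L x k - choiceTail L x (k + 1))
        - β * (tailFraction x (k + 1) - tailFraction x (k + 2))
        = α * (choiceTail L x k - tailFraction x k ^ L)
          - α * (choiceTail L x (k + 1) - tailFraction x (k + 1) ^ L)
          + α * (tailFraction x k ^ L - stablePoint ρ L k ^ L)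
          - α * (tailFraction x (k + 1) ^ L - stablePoint ρ L (k + 1) ^ L)
          - β * (tailFraction x (k + 1) - stablePoint ρ L (k + 1))
          + β * (tailFraction x (k + 2) - stablePoint ρ L (k + 2)) := by
      linear_combination hbal k - hbal (k + 1)
    rw [e]
    refine (mul_le_mul_of_nonneg_left (sq_add_six_le _ _ _ _ _ _) (by positivity)).trans ?_
    simp only [mul_pow]
    have hα2 := sq_nonneg α
    have m1 := mul_le_mul_of_nonneg_left hA0 hα2
    have m2 := mul_le_mul_of_nonneg_left hA1 hα2
    have m3 := mul_le_mul_of_nonneg_left hB0 hα2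
    have m4 := mul_le_mul_of_nonneg_left hB1 hα2
    have p : 0 ≤ α ^ 2 * c ^ 2 := by positivity
    have p2 : 0 ≤ α ^ 2 * (L : ℝ) ^ 2 := by positivity
    have p3 : 0 ≤ β ^ 2 := by positivity
    have n1 := mul_le_mul_of_nonneg_left hu1 p
    set z0 := fluctuation ρ L x k ^ 2
    set z1 := fluctuation ρ L x (k + 1) ^ 2
    set z2 := fluctuation ρ L x (k + 2) ^ 2
    set u0 := stablePoint ρ L k
    have q1 := mul_nonneg p hz0
    have q2 := mul_nonneg p hz1
    have q3 := mul_nonneg p hz2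
    have q4 := mul_nonneg p2 hz2
    have q5 := mul_nonneg p2 hu0
    have q6 := mul_nonneg p3 hz0
    have q7 := mul_nonneg p3 hu0
    have q8 : 0 ≤ 5 * (α + β) * (z0 + z1 + z2 + u0) := by positivity
    have hC1' : N * (β ^ 2 * (tailFraction x (k + 1) - stablePoint ρ L (k + 1)) ^ 2) = β ^ 2 * z1 := by
      rw [hC1]; ring
    have hC2' : N * (β ^ 2 * (tailFraction x (k + 2) - stablePoint ρ L (k + 2)) ^ 2) = β ^ 2 * z2 := by
      rw [hC2]; ring
    linarith
  · have h1 := ha k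
    have h2 := ha0 (k + 1)
    have h3 := hr0 (k + 2)
    have h4 := hR k
    have h5 := hR (k + 1)
    set z0 := fluctuation ρ L x k ^ 2
    set z1 := fluctuation ρ L x (k + 1) ^ 2
    set z2 := fluctuation ρ L x (k + 2) ^ 2
    set u0 := stablePoint ρ L k
    have h6 : α * choiceTail L x k ≤ α * (5 * z0 + 3 * u0) :=
      mul_le_mul_of_nonneg_left (h1.trans h4) hα.le
    have h7 : β * tailFraction x (k + 1) ≤ β * (5 * z1 + 3 * u0) :=
      mul_le_mul_of_nonneg_left (h5.trans (by linarith)) hβ.le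
    have q1 : 0 ≤ 6 * (6 * α ^ 2 * c ^ 2 + α ^ 2 * L ^ 2 + β ^ 2) * (z0 + z1 + z2 + u0) := by
      positivity
    linarith [mul_nonneg hα.le h2, mul_nonneg hβ.le h3, mul_nonneg hα.le hz1, mul_nonneg hα.le hz2,
      mul_nonneg hβ.le hz0, mul_nonneg hβ.le hz2, mul_nonneg hα.le hu0, mul_nonneg hβ.le hu0]

/-! ### The maximal inequality for one level of the network. -/

namespace IsNetworkProcess

variable {α β : ℝ} {L N : ℕ} {Ω : Type*} [mΩ : MeasurableSpace Ω] {P : Measure Ω}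
  {X : ℝ≥0 → Ω → (Fin N → ℕ)}

theorem right_continuous_comp (hX : IsNetworkProcess α β L N P X) (f : (Fin N → ℕ) → ℝ) (ω : Ω)
    (t : ℝ≥0) : ContinuousWithinAt (fun s => f (X s ω)) (Set.Ici t) t :=
  (continuous_of_discreteTopology (f := f)).continuousAt.comp_continuousWithinAt
    (hX.right_continuous ω t)

theorem measurable_comp (hX : IsNetworkProcess α β L N P X) (f : (Fin N → ℕ) → ℝ) (t : ℝ≥0) :
    Measurable fun ω => f (X t ω) := by
  obtain ⟨𝓕, hm, -⟩ := hX.martingale_problem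
  exact (Measurable.of_discrete (f := f)).comp ((hm t).mono (𝓕.le t) le_rfl)

theorem measurable_uncurry_comp (hX : IsNetworkProcess α β L N P X) (f : (Fin N → ℕ) → ℝ) :
    Measurable fun p : ℝ × Ω => f (X p.1.toNNReal p.2) :=
  measurable_uncurry_of_right_continuous (Y := fun t ω => f (X t ω)) (hX.measurable_comp f)
    (hX.right_continuous_comp f)

/-- The maximal inequality for the tail, centred at the stable point and multiplied by N; drift and
bracket are both absorbed by the local energy. The measurable majorant is kept so that levels can
later be summed inside the integral. -/
theorem lintegral_sup_fluctuation_le [IsProbabilityMeasure P] (hα : 0 < α) (hαβ : α < β) {K : ℝ≥0}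
    (hK : ∀ (x : Fin N → ℕ) (k : ℕ),
      N * networkGenerator α β L N (fun x => tailFraction x (k + 1)) x ^ 2
        ≤ K * localEnergy (α / β) L x k ∧
      N * (networkGenerator α β L N (fun x => tailFraction x (k + 1) * tailFraction x (k + 1)) x
        - 2 * (tailFraction x (k + 1)
          * networkGenerator α β L N (fun x => tailFraction x (k + 1)) x))
        ≤ K * localEnergy (α / β) L x k)
    (hX : IsNetworkProcess α β L N P X) (k : ℕ) (t : ℝ≥0) :
    ∃ S : Ω → ℝ≥0∞, Measurable S ∧
      (∀ ω, ∀ s ≤ t, ENNReal.ofReal (fluctuation (α / β) L (X s ω) (k + 1) ^ 2) ≤ S ω) ∧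
      ∫⁻ ω, S ω ∂P
        ≤ 3 * ∫⁻ ω, ENNReal.ofReal (fluctuation (α / β) L (X 0 ω) (k + 1) ^ 2) ∂P
          + (3 * t + 24) * K * ∫⁻ s in Set.Ioc (0 : ℝ) t,
            ∫⁻ ω, ENNReal.ofReal (localEnergy (α / β) L (X s.toNNReal ω) k) ∂P := by
  have hβ : 0 < β := hα.trans hαβ
  obtain ⟨𝓕, hm, hmart⟩ := hX.martingale_problem
  have hrc : ∀ f : (Fin N → ℕ) → ℝ, (∃ C, ∀ x, |f x| ≤ C) →
      IsBoundedRightContinuous 𝓕 fun t ω => f (X t ω) := fun f hf =>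
    { adapted := fun t => (Measurable.of_discrete (f := f)).comp (hm t)
      right_continuous := hX.right_continuous_comp f
      bounded := hf.imp fun C hC t ω => hC _ }
  set f : (Fin N → ℕ) → ℝ := fun x => tailFraction x (k + 1) with hf
  have hfb : ∃ C, ∀ x, |f x| ≤ C := ⟨1, fun x => by
    rw [abs_of_nonneg (tailFraction_nonneg x _)]; exact tailFraction_le_one x _⟩
  have hffb : ∃ C, ∀ x, |f x * f x| ≤ C := ⟨1, fun x => by
    rw [abs_of_nonneg (mul_self_nonneg _)]
    exact mul_le_one₀ (tailFraction_le_one x _) (tailFraction_nonneg x _) (tailFraction_le_one x _)⟩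
  obtain ⟨S, hS, hle, hint⟩ := IsBoundedRightContinuous.lintegral_iSup_sq_le (P := P)
    (hrc f hfb) (hrc _ (exists_abs_networkGenerator_le hα.le hβ.le L hfb))
    (hrc _ (exists_abs_networkGenerator_le hα.le hβ.le L hffb))
    (hmart f hfb) (hmart _ hffb) (stablePoint (α / β) L (k + 1)) t
  have hmul : ∀ a : ℝ, ENNReal.ofReal (N * a) = N * ENNReal.ofReal a := fun a => by
    rw [ENNReal.ofReal_mul (Nat.cast_nonneg _), ENNReal.ofReal_natCast]
  have hNtop : (N : ℝ≥0∞) ≠ ∞ := ENNReal.natCast_ne_top N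
  refine ⟨fun ω => N * S ω, hS.const_mul _, fun ω s hs => ?_, ?_⟩
  · rw [fluctuation_sq, hmul]
    exact mul_le_mul' le_rfl (hle ω s hs)
  rw [lintegral_const_mul _ hS]
  refine (mul_le_mul' le_rfl hint).trans ?_
  set J := ∫⁻ s in Set.Ioc (0 : ℝ) t,
    ∫⁻ ω, ENNReal.ofReal (localEnergy (α / β) L (X s.toNNReal ω) k) ∂P with hJ
  have key : ∀ h : (Fin N → ℕ) → ℝ, (∀ x, N * h x ≤ K * localEnergy (α / β) L x k) →
      N * ∫⁻ s in Set.Ioc (0 : ℝ) t, ∫⁻ ω, ENNReal.ofReal (h (X s.toNNReal ω)) ∂P ≤ K * J := by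
    intro h hh
    rw [hJ, ← lintegral_const_mul' _ _ hNtop, ← lintegral_const_mul' _ _ ENNReal.coe_ne_top]
    refine lintegral_mono fun s => ?_
    rw [← lintegral_const_mul' _ _ hNtop, ← lintegral_const_mul' _ _ ENNReal.coe_ne_top]
    refine lintegral_mono fun ω => ?_
    rw [← hmul, ← ENNReal.ofReal_coe_nnreal, ← ENNReal.ofReal_mul K.coe_nonneg]
    exact ENNReal.ofReal_le_ofReal (hh _)
  have k1 := key (fun x => networkGenerator α β L N f x ^ 2) fun x => (hK x k).1
  have k2 := key (fun x => networkGenerator α β L N (fun x => f x * f x) x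
    - 2 * (f x * networkGenerator α β L N f x)) fun x => (hK x k).2
  have k0 : ∫⁻ ω, ENNReal.ofReal (fluctuation (α / β) L (X 0 ω) (k + 1) ^ 2) ∂P
      = N * ∫⁻ ω, ENNReal.ofReal ((f (X 0 ω) - stablePoint (α / β) L (k + 1)) ^ 2) ∂P := by
    rw [← lintegral_const_mul' _ _ hNtop]
    simp_rw [fluctuation_sq, hmul]
    rfl
  rw [k0, mul_add, mul_add, add_mul, add_mul, add_assoc]
  refine add_le_add (le_of_eq (by ring)) (add_le_add ?_ ?_)
  · rw [mul_left_comm, mul_assoc (3 * (t : ℝ≥0∞))]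
    exact mul_le_mul' le_rfl k1
  · rw [mul_left_comm, mul_assoc (24 : ℝ≥0∞)]
    exact mul_le_mul' le_rfl k2

end IsNetworkProcess

/-! ### Gronwall's inequality and weighted sums over levels. -/

/-- A Gronwall inequality for bounded functions with values in `[0, ∞]`. -/
theorem ENNReal.gronwall {φ : ℝ → ℝ≥0∞} {A M : ℝ≥0∞} {B T : ℝ} (hB : 0 < B) (hM : M ≠ ∞)
    (hφM : ∀ t, 0 ≤ t → t ≤ T → φ t ≤ M)
    (hφ : ∀ t, 0 ≤ t → t ≤ T → φ t ≤ A + ENNReal.ofReal B * ∫⁻ s in Set.Ioc 0 t, φ s) :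
    ∀ t, 0 ≤ t → t ≤ T → φ t ≤ 2 * A * ENNReal.ofReal (Real.exp (2 * B * T)) := by
  set e : ℝ → ℝ≥0∞ := fun t => ENNReal.ofReal (Real.exp (2 * B * t)) with he
  set e' : ℝ → ℝ≥0∞ := fun t => ENNReal.ofReal (Real.exp (-(2 * B * t))) with he'
  have hee : ∀ t, e' t * e t = 1 := fun t => by
    rw [he, he', ← ENNReal.ofReal_mul (Real.exp_pos _).le, ← Real.exp_add]; simp
  have he1 : ∀ t, 0 ≤ t → e' t ≤ 1 := fun t ht => by
    rw [he', ENNReal.ofReal_le_one, Real.exp_le_one_iff, neg_nonpos]; positivity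
  set m : ℝ≥0∞ := ⨆ t ∈ Set.Icc 0 T, e' t * φ t with hm
  have hmM : m ≤ M := iSup₂_le fun t ht =>
    (mul_le_mul' (he1 t ht.1) (hφM t ht.1 ht.2)).trans_eq (one_mul _)
  have hφm : ∀ t, 0 ≤ t → t ≤ T → φ t ≤ m * e t := fun t h0 hT => by
    calc φ t = (e' t * φ t) * e t := by rw [mul_right_comm, hee, one_mul]
      _ ≤ m * e t := mul_le_mul' (le_iSup₂ (f := fun t (_ : t ∈ Set.Icc 0 T) => e' t * φ t) t
          ⟨h0, hT⟩) le_rfl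
  have hint : ∀ t, 0 ≤ t → ENNReal.ofReal B * ∫⁻ s in Set.Ioc 0 t, e s ≤ 2⁻¹ * e t := fun t ht => by
    have h1 : ∫ s in (0 : ℝ)..t, Real.exp (2 * B * s) = (Real.exp (2 * B * t) - 1) / (2 * B) := by
      rw [intervalIntegral.integral_comp_mul_left (fun x => Real.exp x) (by positivity : 2 * B ≠ 0)]
      simp [integral_exp]
      field_simp
    have hc : Continuous fun s : ℝ => Real.exp (2 * B * s) := by fun_prop
    have hi : IntegrableOn (fun s : ℝ => Real.exp (2 * B * s)) (Set.Ioc 0 t) :=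
      (hc.intervalIntegrable 0 t).1
    rw [he, ← ofReal_integral_eq_lintegral_ofReal hi (ae_of_all _ fun s => (Real.exp_pos _).le),
      ← intervalIntegral.integral_of_le ht, h1, ← ENNReal.ofReal_mul hB.le]
    have h2 : (2⁻¹ : ℝ≥0∞) = ENNReal.ofReal 2⁻¹ := by
      rw [ENNReal.ofReal_inv_of_pos (by norm_num)]; simp
    simp only [h2]
    rw [← ENNReal.ofReal_mul (by norm_num)]
    refine ENNReal.ofReal_le_ofReal ?_
    have : B * ((Real.exp (2 * B * t) - 1) / (2 * B)) = 2⁻¹ * (Real.exp (2 * B * t) - 1) := by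
      field_simp
    rw [this]
    linarith
  -- With the norm sup exp(-2Bt) φ(t), the integral operator is a contraction of ratio 1/2. Only
  -- monotonicity of the integral is used, so φ need not be measurable; the a priori bound M allows
  -- m/2 to be cancelled below.
  have hmA : m ≤ A + 2⁻¹ * m := by
    refine iSup₂_le fun t ht => ?_
    have h1 : ∫⁻ s in Set.Ioc 0 t, φ s ≤ m * ∫⁻ s in Set.Ioc 0 t, e s := by
      rw [← lintegral_const_mul' _ _ (ne_top_of_le_ne_top hM hmM)]
      exact setLIntegral_mono' measurableSet_Ioc fun s hs => hφm s hs.1.le (hs.2.trans ht.2)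
    calc e' t * φ t ≤ e' t * (A + ENNReal.ofReal B * (m * ∫⁻ s in Set.Ioc 0 t, e s)) := by
          gcongr; exact (hφ t ht.1 ht.2).trans (by gcongr)
      _ = e' t * A + e' t * m * (ENNReal.ofReal B * ∫⁻ s in Set.Ioc 0 t, e s) := by ring
      _ ≤ 1 * A + e' t * m * (2⁻¹ * e t) := by
          exact add_le_add (mul_le_mul' (he1 t ht.1) le_rfl) (mul_le_mul' le_rfl (hint t ht.1))
      _ = A + (e' t * e t) * (2⁻¹ * m) := by ring
      _ = A + 2⁻¹ * m := by rw [hee, one_mul]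
  have hm2 : m ≤ 2 * A := by
    have h1 : 2⁻¹ * m ≠ ∞ := ENNReal.mul_ne_top (by simp) (ne_top_of_le_ne_top hM hmM)
    have h2 : 2⁻¹ * m + 2⁻¹ * m = m := by rw [← add_mul, ENNReal.inv_two_add_inv_two, one_mul]
    have h3 : 2⁻¹ * m ≤ A := by
      refine (ENNReal.add_le_add_iff_right h1).1 ?_
      rwa [h2]
    calc m = 2 * (2⁻¹ * m) := by rw [two_mul, h2]
      _ ≤ 2 * A := by gcongr
  intro t h0 hT
  refine (hφm t h0 hT).trans (mul_le_mul' hm2 (ENNReal.ofReal_le_ofReal (Real.exp_le_exp.2 ?_)))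
  gcongr

/-- Positive weights with neighbouring values comparable up to the factor `c`. -/
structure IsSlowlyVarying (w : ℕ → ℝ) (c : ℝ≥0) : Prop where
  pos : ∀ k, 0 < w k
  le_succ : ∀ k, w k ≤ c * w (k + 1)
  succ_le : ∀ k, w (k + 1) ≤ c * w k

namespace IsSlowlyVarying

variable {w : ℕ → ℝ} {c : ℝ≥0}

theorem ofReal_sq_mul_inv_le {a b : ℝ} (ha : 0 < a) (hb : 0 < b) (h : b ≤ c * a) (y : ℝ) :
    ENNReal.ofReal (y ^ 2 * a⁻¹) ≤ c * ENNReal.ofReal (y ^ 2 * b⁻¹) := by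
  rw [← ENNReal.ofReal_coe_nnreal, ← ENNReal.ofReal_mul c.coe_nonneg]
  refine ENNReal.ofReal_le_ofReal ?_
  rw [mul_left_comm]
  refine mul_le_mul_of_nonneg_left ?_ (sq_nonneg y)
  rw [inv_le_iff_one_le_mul₀ ha, ← div_eq_mul_inv, div_mul_eq_mul_div, le_div_iff₀ hb]
  linarith

/-- Shifting the level by one in either direction costs a factor c, whence 2c + 1. The downward
shift has no boundary term since the fluctuation vanishes at level 0. -/
theorem tsum_localEnergy_le (hw : IsSlowlyVarying w c) {ρ : ℝ} {L N : ℕ}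
    (hN : 0 < N) (x : Fin N → ℕ) :
    ∑' k, ENNReal.ofReal (w (k + 1))⁻¹ * ENNReal.ofReal (localEnergy ρ L x k)
      ≤ (2 * c + 1) * weightedNormSq w (fluctuation ρ L x)
        + ∑' k, ENNReal.ofReal (stablePoint ρ L k * (w (k + 1))⁻¹) := by
  set z := fluctuation ρ L x with hz
  have hw0 : ∀ k, 0 ≤ (w k)⁻¹ := fun k => inv_nonneg.2 (hw.pos k).le
  have h1 : ∀ k, ENNReal.ofReal (w (k + 1))⁻¹ * ENNReal.ofReal (localEnergy ρ L x k)
      ≤ ENNReal.ofReal (z k ^ 2 * (w (k + 1))⁻¹) + ENNReal.ofReal (z (k + 1) ^ 2 * (w (k + 1))⁻¹)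
        + ENNReal.ofReal (z (k + 2) ^ 2 * (w (k + 1))⁻¹)
        + ENNReal.ofReal (stablePoint ρ L k * (w (k + 1))⁻¹) := fun k => by
    rw [← ENNReal.ofReal_mul (hw0 _), localEnergy, mul_comm, add_mul, add_mul, add_mul]
    exact ENNReal.ofReal_add_le.trans (add_le_add_left (ENNReal.ofReal_add_le.trans
      (add_le_add_left ENNReal.ofReal_add_le _)) _)
  refine (ENNReal.tsum_le_tsum h1).trans ?_
  rw [ENNReal.tsum_add, ENNReal.tsum_add, ENNReal.tsum_add]
  refine add_le_add_left ?_ _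
  have e : (2 * c + 1) * weightedNormSq w z
      = c * weightedNormSq w z + weightedNormSq w z + c * weightedNormSq w z := by ring
  rw [e]
  refine add_le_add (add_le_add ?_ le_rfl) ?_
  · rw [tsum_eq_zero_add' ENNReal.summable, hz, fluctuation_zero x ρ L hN, weightedNormSq,
      ← ENNReal.tsum_mul_left]
    simp only [ne_eq, OfNat.ofNat_ne_zero, not_false_eq_true, zero_pow, zero_mul,
      ENNReal.ofReal_zero, zero_add]
    exact ENNReal.tsum_le_tsum fun k => ofReal_sq_mul_inv_le (hw.pos _) (hw.pos _) (hw.le_succ _) _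
  · rw [weightedNormSq, ← ENNReal.tsum_mul_left]
    refine (ENNReal.tsum_le_tsum fun k =>
      ofReal_sq_mul_inv_le (hw.pos _) (hw.pos _) (hw.succ_le _) _).trans ?_
    exact ENNReal.tsum_comp_le_tsum_of_injective (add_left_injective 1)
      (fun k => (c : ℝ≥0∞) * ENNReal.ofReal (z (k + 1) ^ 2 * (w (k + 1))⁻¹))

end IsSlowlyVarying

/-- The supremum of a sum is at most the sum of the suprema, so the one-level inequalities can be
added with their weights. No finiteness is assumed: both sides may be infinite. -/
theorem IsNetworkProcess.lintegral_iSup_weightedNormSq_le {α β : ℝ} {L N : ℕ} {Ω : Type*}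
    [mΩ : MeasurableSpace Ω] {P : Measure Ω} [IsProbabilityMeasure P] {X : ℝ≥0 → Ω → (Fin N → ℕ)}
    (hα : 0 < α) (hαβ : α < β) (hN : 0 < N) {K : ℝ≥0}
    (hK : ∀ (x : Fin N → ℕ) (k : ℕ),
      N * networkGenerator α β L N (fun x => tailFraction x (k + 1)) x ^ 2
        ≤ K * localEnergy (α / β) L x k ∧
      N * (networkGenerator α β L N (fun x => tailFraction x (k + 1) * tailFraction x (k + 1)) x
        - 2 * (tailFraction x (k + 1)
          * networkGenerator α β L N (fun x => tailFraction x (k + 1)) x))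
        ≤ K * localEnergy (α / β) L x k)
    (hX : IsNetworkProcess α β L N P X) {w : ℕ → ℝ} {c : ℝ≥0} (hw : IsSlowlyVarying w c)
    (t : ℝ≥0) :
    ∫⁻ ω, ⨆ s ∈ Set.Icc (0 : ℝ≥0) t, weightedNormSq w (fluctuation (α / β) L (X s ω)) ∂P
      ≤ 3 * ∫⁻ ω, weightedNormSq w (fluctuation (α / β) L (X 0 ω)) ∂P
        + (3 * t + 24) * K * ∫⁻ s in Set.Ioc (0 : ℝ) t,
          ((2 * c + 1) * ∫⁻ ω, weightedNormSq w (fluctuation (α / β) L (X s.toNNReal ω)) ∂P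
          + ∑' k, ENNReal.ofReal (stablePoint (α / β) L k * (w (k + 1))⁻¹)) := by
  set ρ := α / β with hρ
  choose S hSm hS hSle using hX.lintegral_sup_fluctuation_le hα hαβ hK
  set W : ℕ → ℝ≥0∞ := fun k => ENNReal.ofReal (w (k + 1))⁻¹ with hW
  have hWtop : ∀ k, W k ≠ ∞ := fun k => ENNReal.ofReal_ne_top
  have hnorm : ∀ x : Fin N → ℕ, weightedNormSq w (fluctuation ρ L x)
      = ∑' k, W k * ENNReal.ofReal (fluctuation ρ L x (k + 1) ^ 2) := fun x => by
    refine tsum_congr fun k => ?_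
    rw [ENNReal.ofReal_mul (sq_nonneg _), mul_comm]
  have hzm : ∀ s k, Measurable fun ω => W k * ENNReal.ofReal (fluctuation ρ L (X s ω) (k + 1) ^ 2) :=
    fun s k => ((hX.measurable_comp (fun x => fluctuation ρ L x (k + 1) ^ 2)
      s).ennreal_ofReal).const_mul _
  have hem : ∀ k, Measurable fun p : ℝ × Ω =>
      W k * ENNReal.ofReal (localEnergy ρ L (X p.1.toNNReal p.2) k) := fun k =>
    ((hX.measurable_uncurry_comp fun x => localEnergy ρ L x k).ennreal_ofReal).const_mul _
  calc ∫⁻ ω, ⨆ s ∈ Set.Icc (0 : ℝ≥0) t, weightedNormSq w (fluctuation ρ L (X s ω)) ∂P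
      ≤ ∫⁻ ω, ∑' k, W k * S k t ω ∂P := lintegral_mono fun ω => iSup₂_le fun s hs => by
        rw [hnorm]
        exact ENNReal.tsum_le_tsum fun k => mul_le_mul' le_rfl (hS k t ω s hs.2)
    _ = ∑' k, W k * ∫⁻ ω, S k t ω ∂P := by
        rw [lintegral_tsum fun k => ((hSm k t).const_mul _).aemeasurable]
        exact tsum_congr fun k => lintegral_const_mul _ (hSm k t)
    _ ≤ ∑' k, (3 * ∫⁻ ω, W k * ENNReal.ofReal (fluctuation ρ L (X 0 ω) (k + 1) ^ 2) ∂P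
          + (3 * t + 24) * K * ∫⁻ s in Set.Ioc (0 : ℝ) t,
            ∫⁻ ω, W k * ENNReal.ofReal (localEnergy ρ L (X s.toNNReal ω) k) ∂P) := by
        refine ENNReal.tsum_le_tsum fun k => (mul_le_mul' le_rfl (hSle k t)).trans_eq ?_
        simp_rw [lintegral_const_mul' _ _ (hWtop k)]
        ring
    _ = 3 * ∫⁻ ω, weightedNormSq w (fluctuation ρ L (X 0 ω)) ∂P
          + (3 * t + 24) * K * ∫⁻ s in Set.Ioc (0 : ℝ) t,
            ∫⁻ ω, ∑' k, W k * ENNReal.ofReal (localEnergy ρ L (X s.toNNReal ω) k) ∂P := by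
        rw [ENNReal.tsum_add, ENNReal.tsum_mul_left, ENNReal.tsum_mul_left,
          ← lintegral_tsum fun k => (hzm 0 k).aemeasurable,
          ← lintegral_tsum fun k => ((hem k).lintegral_prod_right').aemeasurable]
        simp_rw [hnorm]
        congr 3
        ext s
        exact (lintegral_tsum fun k =>
          ((hem k).comp (measurable_prodMk_left (x := s))).aemeasurable).symm
    _ ≤ _ := by
        refine add_le_add le_rfl (mul_le_mul' le_rfl (lintegral_mono fun s => ?_))
        refine (lintegral_mono fun ω => hw.tsum_localEnergy_le hN (X s.toNNReal ω)).trans ?_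
        rw [lintegral_add_right _ measurable_const, lintegral_const_mul' _ _ (by finiteness)]
        simp

/-- The geometric sequence of reason `θ`, made larger than `δ * 2 ^ k`. -/
def cutWeight (θ δ : ℝ) (k : ℕ) : ℝ := max (geometricWeight θ k) (δ * 2 ^ k)

/-- The point is that the constant does not depend on δ; it dominates θ, θ⁻¹ and 2, the one-step
ratios involved. -/
theorem isSlowlyVarying_cutWeight {θ δ : ℝ} (hθ : 0 < θ) (hδ : 0 ≤ δ) :
    IsSlowlyVarying (cutWeight θ δ) (θ + θ⁻¹ + 2).toNNReal := by
  have hc : ((θ + θ⁻¹ + 2).toNNReal : ℝ) = θ + θ⁻¹ + 2 := Real.coe_toNNReal _ (by positivity)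
  have hinv : 0 < θ⁻¹ := inv_pos.2 hθ
  constructor
  · intro k
    exact lt_of_lt_of_le (pow_pos hθ k) (le_max_left _ _)
  · intro k
    rw [hc, cutWeight, cutWeight, mul_max_of_nonneg _ _ (by positivity)]
    refine max_le_max ?_ ?_
    · calc geometricWeight θ k = θ⁻¹ * geometricWeight θ (k + 1) := by
            simp only [geometricWeight, pow_succ]; field_simp
        _ ≤ _ := mul_le_mul_of_nonneg_right (by linarith) (pow_pos hθ _).le
    · rw [pow_succ]
      nlinarith [(by positivity : 0 ≤ δ * 2 ^ k), mul_nonneg hθ.le (by positivity : 0 ≤ δ * 2 ^ k),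
        mul_nonneg hinv.le (by positivity : 0 ≤ δ * 2 ^ k)]
  · intro k
    rw [hc, cutWeight, cutWeight, mul_max_of_nonneg _ _ (by positivity)]
    refine max_le_max ?_ ?_
    · calc geometricWeight θ (k + 1) = θ * geometricWeight θ k := by
            simp only [geometricWeight, pow_succ]; ring
        _ ≤ _ := mul_le_mul_of_nonneg_right (by linarith) (pow_pos hθ _).le
    · rw [pow_succ]
      nlinarith [(by positivity : 0 ≤ δ * 2 ^ k), mul_nonneg hθ.le (by positivity : 0 ≤ δ * 2 ^ k),
        mul_nonneg hinv.le (by positivity : 0 ≤ δ * 2 ^ k)]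

theorem cutWeight_zero {θ : ℝ} (hθ : 0 < θ) : cutWeight θ 0 = geometricWeight θ := by
  ext k
  rw [cutWeight, zero_mul, max_eq_left (show 0 ≤ geometricWeight θ k from (pow_pos hθ k).le)]

theorem cutWeight_inv_le {θ : ℝ} (hθ : 0 < θ) (δ : ℝ) (k : ℕ) :
    (cutWeight θ δ k)⁻¹ ≤ (geometricWeight θ k)⁻¹ :=
  inv_anti₀ (pow_pos hθ k) (le_max_left _ _)

theorem exists_cutWeight_eq {θ : ℝ} (hθ : 0 < θ) (n : ℕ) :
    ∃ δ, 0 < δ ∧ ∀ k ≤ n, cutWeight θ δ k = geometricWeight θ k := by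
  have h0 : 0 < min 1 (θ / 2) := lt_min one_pos (by positivity)
  refine ⟨min 1 (θ / 2) ^ n, pow_pos h0 n, fun k hk => max_eq_left ?_⟩
  calc min 1 (θ / 2) ^ n * 2 ^ k ≤ (θ / 2) ^ k * 2 ^ k := by
        gcongr
        exact (pow_le_pow_of_le_one h0.le (min_le_left _ _) hk).trans
          (pow_le_pow_left₀ h0.le (min_le_right _ _) k)
    _ = geometricWeight θ k := by rw [← mul_pow, geometricWeight]; congr 1; ring

theorem tsum_ofReal_cutWeight_inv_ne_top (θ : ℝ) {δ : ℝ} (hδ : 0 < δ) :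
    ∑' k, ENNReal.ofReal (cutWeight θ δ (k + 1))⁻¹ ≠ ∞ := by
  have hs : Summable fun k : ℕ => δ⁻¹ * (1 / 2 : ℝ) ^ k := summable_geometric_two.mul_left _
  refine ne_top_of_le_ne_top hs.tsum_ofReal_ne_top (ENNReal.tsum_le_tsum fun k =>
    ENNReal.ofReal_le_ofReal ?_)
  have h1 : δ * 2 ^ k ≤ cutWeight θ δ (k + 1) := by
    refine le_trans ?_ (le_max_right _ _)
    gcongr <;> norm_num
  refine (inv_anti₀ (by positivity) h1).trans_eq ?_
  rw [mul_inv, one_div, inv_pow]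

/-! ### The uniform bound, and the dichotomy on θ. -/

/-- Bounds on the means that hold uniformly in the size of the network. -/
theorem IsNetworkProcess.exists_uniform_bound {α β : ℝ} (hα : 0 < α) (hαβ : α < β) {L : ℕ}
    (hL : 1 ≤ L) {θ : ℝ} (hθ : 0 < θ)
    (hD : ∑' k, ENNReal.ofReal (stablePoint (α / β) L k * (geometricWeight θ (k + 1))⁻¹) ≠ ∞)
    (T : ℝ≥0) {A : ℝ≥0∞} (hA : A ≠ ∞) :
    ∃ B : ℝ≥0∞, B ≠ ∞ ∧ ∀ (N : ℕ) (Ω : Type*) [MeasurableSpace Ω] (P : Measure Ω)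
      [IsProbabilityMeasure P] (X : ℝ≥0 → Ω → (Fin N → ℕ)), L ≤ N →
      IsNetworkProcess α β L N P X →
      ∫⁻ ω, weightedNormSq (geometricWeight θ) (fluctuation (α / β) L (X 0 ω)) ∂P ≤ A →
      ∫⁻ ω, ⨆ t ∈ Set.Icc (0 : ℝ≥0) T,
        weightedNormSq (geometricWeight θ) (fluctuation (α / β) L (X t ω)) ∂P ≤ B := by
  have hβ : 0 < β := hα.trans hαβ
  have hρ : 0 < α / β := div_pos hα hβ
  have hρ1 : α / β ≤ 1 := (div_le_one hβ).2 hαβ.le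
  obtain ⟨K, hK⟩ := exists_drift_and_bracket_le hα hαβ hL
  set ρ := α / β with hρdef
  set D := ∑' k, ENNReal.ofReal (stablePoint ρ L k * (geometricWeight θ (k + 1))⁻¹) with hDdef
  set c : ℝ≥0 := (θ + θ⁻¹ + 2).toNNReal with hc
  -- K + 1 instead of K makes the Gronwall rate positive.
  set E : ℝ≥0 := (3 * T + 24) * (K + 1) with hE
  have hEpos : 0 < E := by positivity
  set G : ℝ≥0 := E * (2 * c + 1) with hG
  have hGpos : 0 < G := by positivity
  set A' : ℝ≥0∞ := 3 * A + E * (T * D) with hA'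
  have hA'top : A' ≠ ∞ := by
    rw [hA']
    exact ENNReal.add_ne_top.2 ⟨ENNReal.mul_ne_top (by simp) hA,
      ENNReal.mul_ne_top (by simp) (ENNReal.mul_ne_top (by simp) hD)⟩
  set B' : ℝ≥0∞ := 2 * A' * ENNReal.ofReal (Real.exp (2 * G * T)) with hB'
  have hB'top : B' ≠ ∞ := ENNReal.mul_ne_top (ENNReal.mul_ne_top (by simp) hA'top) (by simp)
  refine ⟨A' + G * (T * B'), ENNReal.add_ne_top.2 ⟨hA'top,
    ENNReal.mul_ne_top (by simp) (ENNReal.mul_ne_top (by simp) hB'top)⟩, ?_⟩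
  intro N Ω _ P _ X hN hX h0
  have hN0 : 0 < N := by omega
  have hnorm : ∀ (δ : ℝ) (z : ℕ → ℝ),
      weightedNormSq (cutWeight θ δ) z ≤ weightedNormSq (geometricWeight θ) z := fun δ z =>
    ENNReal.tsum_le_tsum fun k => ENNReal.ofReal_le_ofReal
      (mul_le_mul_of_nonneg_left (cutWeight_inv_le hθ δ _) (sq_nonneg _))
  -- the integral inequality, for all the weights at once
  have step : ∀ δ, 0 ≤ δ → ∀ t ≤ T, ∫⁻ ω, ⨆ s ∈ Set.Icc (0 : ℝ≥0) t,
      weightedNormSq (cutWeight θ δ) (fluctuation ρ L (X s ω)) ∂P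
      ≤ A' + G * ∫⁻ s in Set.Ioc (0 : ℝ) t,
        ∫⁻ ω, weightedNormSq (cutWeight θ δ) (fluctuation ρ L (X s.toNNReal ω)) ∂P := by
    intro δ hδ t ht
    refine (hX.lintegral_iSup_weightedNormSq_le hα hαβ hN0 (hK N hN)
      (isSlowlyVarying_cutWeight hθ hδ) t).trans ?_
    have hDδ : ∑' k, ENNReal.ofReal (stablePoint ρ L k * (cutWeight θ δ (k + 1))⁻¹) ≤ D :=
      ENNReal.tsum_le_tsum fun k => ENNReal.ofReal_le_ofReal
        (mul_le_mul_of_nonneg_left (cutWeight_inv_le hθ δ _) (stablePoint_pos hρ L k).le)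
    rw [lintegral_add_right _ measurable_const, lintegral_const_mul' _ _ (by finiteness),
      lintegral_const, Measure.restrict_apply_univ, Real.volume_Ioc, sub_zero,
      ENNReal.ofReal_coe_nnreal]
    have hE1 : (3 * (t : ℝ≥0∞) + 24) * K ≤ E := by
      have : (3 * t + 24) * K ≤ E := by
        rw [hE]; gcongr; exact le_self_add
      exact_mod_cast this
    set J := ∫⁻ s in Set.Ioc (0 : ℝ) t,
      ∫⁻ ω, weightedNormSq (cutWeight θ δ) (fluctuation ρ L (X s.toNNReal ω)) ∂P with hJ
    calc 3 * ∫⁻ ω, weightedNormSq (cutWeight θ δ) (fluctuation ρ L (X 0 ω)) ∂P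
          + (3 * (t : ℝ≥0∞) + 24) * K * ((2 * c + 1) * J
            + (∑' k, ENNReal.ofReal (stablePoint ρ L k * (cutWeight θ δ (k + 1))⁻¹)) * t)
        ≤ 3 * A + E * ((2 * c + 1) * J + D * T) := by
          gcongr
          exact (lintegral_mono fun ω => hnorm δ _).trans h0
      _ = A' + G * J := by
          rw [hA', hG]; push_cast; ring
  -- bounds at fixed times, for the weights of finite total mass
  have fixed : ∀ δ, 0 < δ → ∀ t ≤ T,
      ∫⁻ ω, weightedNormSq (cutWeight θ δ) (fluctuation ρ L (X t ω)) ∂P ≤ B' := by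
    intro δ hδ t ht
    set φ : ℝ → ℝ≥0∞ := fun s =>
      ∫⁻ ω, weightedNormSq (cutWeight θ δ) (fluctuation ρ L (X s.toNNReal ω)) ∂P with hφ
    have hM : N * ∑' k, ENNReal.ofReal (cutWeight θ δ (k + 1))⁻¹ ≠ ∞ :=
      ENNReal.mul_ne_top (by simp) (tsum_ofReal_cutWeight_inv_ne_top θ hδ)
    have hφM : ∀ s, φ s ≤ N * ∑' k, ENNReal.ofReal (cutWeight θ δ (k + 1))⁻¹ := fun s => by
      calc φ s ≤ ∫⁻ _, N * ∑' k, ENNReal.ofReal (cutWeight θ δ (k + 1))⁻¹ ∂P := by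
            refine lintegral_mono fun ω => ?_
            rw [weightedNormSq, ← ENNReal.tsum_mul_left]
            refine ENNReal.tsum_le_tsum fun k => ?_
            rw [← ENNReal.ofReal_natCast, ← ENNReal.ofReal_mul (Nat.cast_nonneg _)]
            refine ENNReal.ofReal_le_ofReal (mul_le_mul_of_nonneg_right
              (fluctuation_sq_le _ hρ hρ1 _ _)
              (inv_nonneg.2 ((isSlowlyVarying_cutWeight hθ hδ.le).pos _).le))
        _ = _ := by simp
    have hgr := ENNReal.gronwall (φ := φ) (A := A') (B := G) (T := T) (by exact_mod_cast hGpos) hM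
      (fun s _ _ => hφM s) (fun s hs hsT => ?_) t t.coe_nonneg ht
    · simpa [hφ] using hgr
    · have hs' : s.toNNReal ≤ T := Real.toNNReal_le_iff_le_coe.2 hsT
      have := step δ hδ.le s.toNNReal hs'
      rw [Real.coe_toNNReal s hs] at this
      rw [ENNReal.ofReal_coe_nnreal]
      refine le_trans (lintegral_mono fun ω => ?_) this
      exact le_iSup₂ (f := fun r (_ : r ∈ Set.Icc (0 : ℝ≥0) s.toNNReal) =>
        weightedNormSq (cutWeight θ δ) (fluctuation ρ L (X r ω))) s.toNNReal ⟨zero_le, le_rfl⟩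
  have fixed' : ∀ t ≤ T,
      ∫⁻ ω, weightedNormSq (geometricWeight θ) (fluctuation ρ L (X t ω)) ∂P ≤ B' := by
    intro t ht
    have hm : ∀ w k, AEMeasurable
        (fun ω => ENNReal.ofReal (fluctuation ρ L (X t ω) (k + 1) ^ 2 * w)) P := fun w k =>
      ((hX.measurable_comp (fun x => fluctuation ρ L x (k + 1) ^ 2 * w)
        t).ennreal_ofReal).aemeasurable
    simp only [weightedNormSq]
    rw [lintegral_tsum fun k => hm _ k]
    -- A finite partial sum does not see the cut once δ is small, and the bound is the same for
    -- every δ.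
    refine ENNReal.tsum_le_of_sum_range_le fun n => ?_
    obtain ⟨δ, hδ, hδn⟩ := exists_cutWeight_eq hθ n
    refine le_trans ?_ (fixed δ hδ t ht)
    simp only [weightedNormSq]
    rw [lintegral_tsum fun k => hm _ k]
    refine le_trans (le_of_eq ?_) (ENNReal.sum_le_tsum (Finset.range n))
    refine Finset.sum_congr rfl fun k hk => ?_
    rw [hδn (k + 1) (Finset.mem_range.1 hk)]
  -- The supremum is recovered by using the integral inequality once more, now with the original
  -- weight and the fixed-time bounds on the right.
  have hfin := step 0 le_rfl T le_rfl
  rw [cutWeight_zero hθ] at hfin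
  refine hfin.trans (add_le_add le_rfl (mul_le_mul' le_rfl ?_))
  calc ∫⁻ s in Set.Ioc (0 : ℝ) T,
        ∫⁻ ω, weightedNormSq (geometricWeight θ) (fluctuation ρ L (X s.toNNReal ω)) ∂P
      ≤ ∫⁻ _ in Set.Ioc (0 : ℝ) T, B' := setLIntegral_mono' measurableSet_Ioc fun s hs =>
        fixed' _ (Real.toNNReal_le_iff_le_coe.2 hs.2)
    _ = T * B' := by
        rw [lintegral_const, Measure.restrict_apply_univ, Real.volume_Ioc, sub_zero,
          ENNReal.ofReal_coe_nnreal, mul_comm]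

/-- Ratio test: successive terms have ratio ρ^(L^k)/θ, which tends to 0 if L ≥ 2 and is the constant
ρ/θ if L = 1. -/
theorem tsum_stablePoint_ne_top {ρ θ : ℝ} (hρ : 0 < ρ) (hρ1 : ρ < 1) (hθ : 0 < θ) {L : ℕ}
    (hL : 1 ≤ L) (h : L = 1 → ρ < θ) :
    ∑' k, ENNReal.ofReal (stablePoint ρ L k * (geometricWeight θ (k + 1))⁻¹) ≠ ∞ := by
  have hu := stablePoint_pos hρ L
  set f : ℕ → ℝ := fun k => stablePoint ρ L k * (geometricWeight θ (k + 1))⁻¹ with hf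
  have hfpos : ∀ k, 0 < f k := fun k => mul_pos (hu k) (inv_pos.2 (pow_pos hθ _))
  have hratio : ∀ k, ‖f (k + 1)‖ / ‖f k‖ = ρ ^ L ^ k / θ := fun k => by
    rw [Real.norm_of_nonneg (hfpos _).le, Real.norm_of_nonneg (hfpos _).le,
      div_eq_div_iff (hfpos k).ne' hθ.ne']
    simp only [hf, stablePoint, geometricWeight, Finset.sum_range_succ, pow_add, pow_one]
    field_simp
  have key : ∃ l < 1, Tendsto (fun k => ‖f (k + 1)‖ / ‖f k‖) atTop (𝓝 l) := by
    simp_rw [hratio]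
    rcases hL.eq_or_lt with h1 | h1
    · subst h1
      exact ⟨ρ / θ, (div_lt_one hθ).2 (h rfl), by simp⟩
    · refine ⟨0, one_pos, ?_⟩
      have := (tendsto_pow_atTop_nhds_zero_of_lt_one hρ.le hρ1).comp
        (tendsto_pow_atTop_atTop_of_one_lt h1)
      simpa using this.div_const θ
  obtain ⟨l, hl, hlim⟩ := key
  exact (summable_of_ratio_test_tendsto_lt_one hl
    (Eventually.of_forall fun k => (hfpos k).ne') hlim).tsum_ofReal_ne_top

/-- With one choice and a weight decaying faster than the stable point, the fluctuations are
unbounded in the size of the network, because empirical tails are multiples of `1 / N`. -/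
theorem exists_lt_weightedNormSq {ρ θ : ℝ} (hρ : 0 < ρ) (hρ1 : ρ < 1) (hθ : 0 < θ) (h : θ < ρ)
    (B : ℝ) (N₀ : ℕ) :
    ∃ N ≥ N₀, ∀ x : Fin N → ℕ,
      ENNReal.ofReal B < weightedNormSq (geometricWeight θ) (fluctuation ρ 1 x) := by
  have ht1 : Tendsto (fun k : ℕ => ρ⁻¹ ^ k) atTop atTop :=
    tendsto_pow_atTop_atTop_of_one_lt ((one_lt_inv₀ hρ).2 hρ1)
  have ht2 : Tendsto (fun k : ℕ => (ρ / θ) ^ k) atTop atTop :=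
    tendsto_pow_atTop_atTop_of_one_lt ((one_lt_div hθ).2 h)
  -- With R = ρ^(-k), N will be the integer part of R/2, so 1/N ≥ 2ρ^k. The first bound gives N ≥ N₀
  -- and N ≥ R/4; the second makes N ρ^(2k)/θ^k ≥ (ρ/θ)^k/4 exceed |B|.
  obtain ⟨k, hk1, hk2, hk0⟩ := ((ht1.eventually_ge_atTop (2 * (N₀ + 1) + 4)).and
    ((ht2.eventually_gt_atTop (4 * |B|)).and (eventually_ge_atTop 1))).exists
  have hρk : 0 < ρ ^ k := pow_pos hρ k
  have hinv : ρ⁻¹ ^ k * ρ ^ k = 1 := by rw [← mul_pow, inv_mul_cancel₀ hρ.ne', one_pow]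
  set R := ρ⁻¹ ^ k with hR
  have hfl : (⌊R / 2⌋₊ : ℝ) ≤ R / 2 := Nat.floor_le (by linarith)
  have hlt : R / 2 < ⌊R / 2⌋₊ + 1 := Nat.lt_floor_add_one _
  set N := ⌊R / 2⌋₊ with hN
  refine ⟨N, Nat.le_floor (by linarith), fun x => ?_⟩
  have hNpos : (0 : ℝ) < N := by linarith
  have hu : stablePoint ρ 1 k = ρ ^ k := by simp [stablePoint]
  -- the tail at level `k` is `0` or at least `2 * ρ ^ k`
  have hz : N * (ρ ^ k) ^ 2 ≤ fluctuation ρ 1 x k ^ 2 := by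
    rw [fluctuation_sq, hu]
    refine mul_le_mul_of_nonneg_left ?_ hNpos.le
    rcases Nat.eq_zero_or_pos (Finset.univ.filter fun i => k ≤ x i).card with h0 | h0
    · rw [tailFraction, h0]; simp
    · have h1 : 2 * ρ ^ k ≤ tailFraction x k := by
        rw [tailFraction, le_div_iff₀ hNpos]
        have h2 : (1 : ℝ) ≤ (Finset.univ.filter fun i => k ≤ x i).card := by exact_mod_cast h0
        nlinarith
      exact pow_le_pow_left₀ hρk.le (by linarith) 2
  have hterm : ENNReal.ofReal (fluctuation ρ 1 x k ^ 2 * (geometricWeight θ k)⁻¹)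
      ≤ weightedNormSq (geometricWeight θ) (fluctuation ρ 1 x) := by
    obtain ⟨j, rfl⟩ := Nat.exists_eq_add_of_le' hk0
    exact ENNReal.le_tsum (f := fun j => ENNReal.ofReal
      (fluctuation ρ 1 x (j + 1) ^ 2 * (geometricWeight θ (j + 1))⁻¹)) j
  refine lt_of_lt_of_le ?_ hterm
  have hθk : 0 < θ ^ k := pow_pos hθ k
  have hN4 : R / 4 ≤ N := by linarith
  have hbig : |B| < fluctuation ρ 1 x k ^ 2 * (geometricWeight θ k)⁻¹ := by
    rw [geometricWeight, ← div_eq_mul_inv, lt_div_iff₀ hθk]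
    rw [div_pow, lt_div_iff₀ hθk] at hk2
    have : R / 4 * (ρ ^ k) ^ 2 ≤ N * (ρ ^ k) ^ 2 := by gcongr
    have e : R / 4 * (ρ ^ k) ^ 2 = ρ ^ k / 4 := by linear_combination (ρ ^ k / 4) * hinv
    linarith
  exact (ENNReal.ofReal_le_ofReal (le_abs_self B)).trans_lt
    ((ENNReal.ofReal_lt_ofReal_iff ((abs_nonneg B).trans_lt hbig)).2 hbig)

theorem mainTheorem8 (α β : ℝ) (hα : 0 < α) (hαβ : α < β) (L : ℕ) (hL : 1 ≤ L)
    (θ : ℝ) (hθ : 0 < θ) (hθL : L = 1 → θ ≠ α / β) (T : ℝ≥0)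
    (Ω : ℕ → Type*) [∀ N, MeasurableSpace (Ω N)]
    (P : ∀ N, Measure (Ω N)) [∀ N, IsProbabilityMeasure (P N)]
    (X : ∀ N, ℝ≥0 → Ω N → (Fin N → ℕ))
    (hX : ∀ N, L ≤ N → IsNetworkProcess α β L N (P N) (X N))
    (h0 : limsup (fun N => ∫⁻ ω,
        weightedNormSq (geometricWeight θ) (fluctuation (α / β) L (X N 0 ω)) ∂(P N)) atTop < ∞) :
    limsup (fun N => ∫⁻ ω, ⨆ t ∈ Set.Icc (0 : ℝ≥0) T,
        weightedNormSq (geometricWeight θ) (fluctuation (α / β) L (X N t ω)) ∂(P N)) atTop < ∞ := by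
  have hβ : 0 < β := hα.trans hαβ
  have hρ : 0 < α / β := div_pos hα hβ
  have hρ1 : α / β < 1 := (div_lt_one hβ).2 hαβ
  obtain ⟨A, hA0, hAtop⟩ := exists_between h0
  have hev := eventually_lt_of_limsup_lt hA0
  -- At the excluded value θ = ρ with L = 1 both branches would fail: the source series diverges,
  -- and the lower bound (ρ/θ)^k/4 stays bounded.
  by_cases hcase : L = 1 → α / β < θ
  · obtain ⟨B, hB, hbound⟩ := IsNetworkProcess.exists_uniform_bound hα hαβ hL hθ
      (tsum_stablePoint_ne_top hρ hρ1 hθ hL hcase) T hAtop.ne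
    refine lt_of_le_of_lt (limsup_le_of_le (h := ?_)) hB.lt_top
    filter_upwards [hev, eventually_ge_atTop L] with N h1 h2
    exact hbound N (Ω N) (P N) (X N) h2 (hX N h2) h1.le
  · exfalso
    push Not at hcase
    obtain ⟨rfl, hle⟩ := hcase
    obtain ⟨N₀, hN₀⟩ := eventually_atTop.1 hev
    obtain ⟨N, hN, hbig⟩ := exists_lt_weightedNormSq hρ hρ1 hθ
      (lt_of_le_of_ne hle (hθL rfl)) A.toReal N₀
    refine (hN₀ N hN).not_ge ?_
    calc A = ∫⁻ _, ENNReal.ofReal A.toReal ∂(P N) := by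
          rw [ENNReal.ofReal_toReal hAtop.ne]; simp
      _ ≤ _ := lintegral_mono fun ω => (hbig _).le
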